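/- Let $W$ be a Gaussian white noise on $\mathbb R$ with Lebesgue control measure (a centered Gaussian family $W(A)$, indexed by the Borel sets $A$ of finite measure, with $E[W(A)W(B)]=|A\cap B|$), and let $I_k(f)=\int'_{\mathbb R^k} f(x_1,\dots,x_k)\,W(dx_1)\cdots W(dx_k)$ denote the $k$-fold Wiener–Itô integral of $f\in L^2(\mathbb R^k)$. Write $x_+^a=x^a$ for $x>0$ and $x_+^a=0$ for $x\le 0$, and let $K_\nu$ be the modified Bessel function of the second kind. Let $k\ge 1$ be an integer, $\lambda>0$, $d>\frac12-\frac1{2k}$, $H:=1+k(d-\frac12)$, and let $\beta\neq 0$ satisfy $$-1<\beta,\qquad -H<\beta<\tfrac12 .$$ For $t\in\mathbb R$ put $l_t^\beta(u)=(t-u)_+^\beta-(-u)_+^\beta$ and $$h_t(x_1,\dots,x_k)=\int_{\mathbb R} l_t^\beta(u)\prod_{i=1}^k (u-x_i)_+^{d-1}e^{-\lambda(u-x_i)_+}\,du .$$ Then for every $t\in\mathbb R$ the integral defining $h_t(x)$ converges absolutely for almost every $x\in\mathbb R^k$, and $h_t\in L^2(\mathbb R^k)$, so that the filtered tempered Hermite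 process $Z^\lambda(t):=I_k(h_t)$ is well defined. For every $\tau>0$ the double integral in $$C_\tau:=k!\left(\frac{\Gamma(d)}{\sqrt\pi\,(2\lambda)^{d-1/2}}\right)^{k}\int_{\mathbb R}\int_{\mathbb R}\bigl[(1-u)_+^\beta-(-u)_+^\beta\bigr]\bigl[(1-v)_+^\beta-(-v)_+^\beta\bigr]\,|u-v|^{k(d-1/2)}\,K_{1/2-d}\bigl(\lambda\tau|u-v|\bigr)^{k}\,dv\,du$$ converges absolutely, and for all $t,s\in\mathbb R$ $$E\bigl(Z^\lambda(t)Z^\lambda(s)\bigr)=\tfrac12\Bigl[C_{|t|}|t|^{2\beta+2+k(d-1/2)}+C_{|s|}|s|^{2\beta+2+k(d-1/2)}-C_{|t-s|}|t-s|^{2\beta+2+k(d-1/2)}\Bigr],$$ where a term $C_{|r|}|r|^{2\beta+2+k(d-1/2)}$ with $r=0$ is read as $0$. -/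

import Mathlib

open MeasureTheory ProbabilityTheory
open scoped ENNReal

noncomputable section

namespace TemperedHermite

/-- The positive-part power `x ↦ (x)₊ ^ a`, equal to `x ^ a` for `x > 0` and to `0` for `x ≤ 0`
(also for negative exponents `a`). -/
def posPow (x a : ℝ) : ℝ := if 0 < x then x ^ a else 0

/-- The modified Bessel function of the second kind
`K_ν(x) = ∫₀^∞ exp (- x cosh r) cosh (ν r) dr`, for real order `ν` and `x > 0`. -/
def besselK (ν x : ℝ) : ℝ :=
  ∫ r in Set.Ioi (0 : ℝ), Real.exp (-x * Real.cosh r) * Real.cosh (ν * r)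

/-- The Borel sets of the real line of finite Lebesgue measure. -/
abbrev FinMeasSet : Type := {A : Set ℝ // MeasurableSet A ∧ volume A ≠ ∞}

/-- `W` is a Gaussian white noise on the real line with Lebesgue control measure: a centered
Gaussian family indexed by the Borel sets of finite measure, with `E[W(A) W(B)] = |A ∩ B|`. -/
structure IsWhiteNoise {Ω : Type*} [MeasurableSpace Ω] (W : FinMeasSet → Ω → ℝ)
    (P : Measure Ω) : Prop where
  isGaussianProcess : IsGaussianProcess W P
  mean_eq_zero : ∀ A, ∫ ω, W A ω ∂P = 0
  covariance_eq : ∀ A B, ∫ ω, W A ω * W B ω ∂P = volume.real (A.1 ∩ B.1)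

/-- The graph of the `k`-fold Wiener–Itô integral, as a closed subspace of `L²(ℝᵏ) × L²(Ω)`.
An off-diagonal rectangle `A₁ × ⋯ × A_k` (the `Aᵢ` pairwise disjoint, of finite measure) is sent to
`W(A₁) ⋯ W(A_k)`; this is extended linearly to off-diagonal step functions and then by
`L²`-limits. -/
def wienerItoGraph {Ω : Type*} [MeasurableSpace Ω] (W : FinMeasSet → Ω → ℝ) (P : Measure Ω)
    (k : ℕ) : Submodule ℝ (Lp ℝ 2 (volume : Measure (Fin k → ℝ)) × Lp ℝ 2 P) :=
  (Submodule.span ℝ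
    {p | ∃ A : Fin k → FinMeasSet,
      (∀ i j, i ≠ j → Disjoint (A i).1 (A j).1) ∧
      (p.1 =ᵐ[volume] (Set.univ.pi fun i => (A i).1).indicator fun _ => (1 : ℝ)) ∧
      (p.2 =ᵐ[P] fun ω => ∏ i, W (A i) ω)}).topologicalClosure

open Classical in
/-- The `k`-fold Wiener–Itô integral `I_k(f) = ∫' f(x₁,…,x_k) W(dx₁) ⋯ W(dx_k)` of
`f ∈ L²(ℝᵏ)`: the random variable that the graph above attaches to the class of `f`
(and `0` if `f` is not in `L²`). -/
def wienerItoIntegral {Ω : Type*} [MeasurableSpace Ω] (W : FinMeasSet → Ω → ℝ) (P : Measure Ω)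
    (k : ℕ) (f : (Fin k → ℝ) → ℝ) : Ω → ℝ :=
  if h : ∃ p ∈ wienerItoGraph W P k, p.1 =ᵐ[volume] f then ⇑h.choose.2 else 0

/-- The filter `l_t^β(u) = (t - u)₊^β - (-u)₊^β`. -/
def fracFilter (β t u : ℝ) : ℝ := posPow (t - u) β - posPow (-u) β

/-- The integrand `l_t^β(u) ∏ᵢ (u - xᵢ)₊^(d-1) exp (-λ (u - xᵢ)₊)` of the filtered tempered
Hermite kernel. -/
def kernelIntegrand (k : ℕ) (d lam β t : ℝ) (x : Fin k → ℝ) (u : ℝ) : ℝ :=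
  fracFilter β t u * ∏ i, (posPow (u - x i) (d - 1) * Real.exp (-lam * max (u - x i) 0))

/-- The filtered tempered Hermite kernel `h_t`. -/
def kernel (k : ℕ) (d lam β t : ℝ) (x : Fin k → ℝ) : ℝ :=
  ∫ u, kernelIntegrand k d lam β t x u

/-- The filtered tempered Hermite process `Z(t) = I_k(h_t)`. -/
def process {Ω : Type*} [MeasurableSpace Ω] (W : FinMeasSet → Ω → ℝ) (P : Measure Ω)
    (k : ℕ) (d lam β t : ℝ) : Ω → ℝ :=
  wienerItoIntegral W P k (kernel k d lam β t)

/-- The integrand of the double integral in `C_τ`. -/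
def constIntegrand (k : ℕ) (d lam β τ u v : ℝ) : ℝ :=
  (posPow (1 - u) β - posPow (-u) β) * (posPow (1 - v) β - posPow (-v) β) *
    |u - v| ^ ((k : ℝ) * (d - 1 / 2)) * besselK (1 / 2 - d) (lam * τ * |u - v|) ^ k

/-- The constant `C_τ` of the covariance formula. -/
def covConst (k : ℕ) (d lam β τ : ℝ) : ℝ :=
  (k.factorial : ℝ) *
    (Real.Gamma d / (Real.sqrt Real.pi * (2 * lam) ^ (d - 1 / 2))) ^ k *
    ∫ u, ∫ v, constIntegrand k d lam β τ u v

end TemperedHermite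

end

/-!
# Covariance of the filtered tempered Hermite process

Write `g` for the tempered kernel `y ↦ y₊ ^ (d - 1) exp (-λ y₊)`, `γ` for its autocovariance and
`l_t` for the fractional filter. Everything reduces to the quadratic form
`V t = ∫∫ l_t(u) l_t(v) γ(u - v) ^ k du dv`.

* **Bessel function.** `γ` is an explicit power times `K_{1/2 - d}` (`lintegral_autocovariance`).
  To see this, multiply the integral for `K` by the Gamma integral for `Γ d`, exchange the order of
  integration, which leaves the elementary Bessel function of order `1/2` inside, and substitute
  `ρ = 4 y (y + r) / r²`. All integrands are positive, so the computation takes place in `ℝ≥0∞`.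
* **Finiteness of `V`.** `γ(r)` is bounded by `C |r| ^ (-b) exp (-λ |r| / 2)` for every `b > 0`
  above `1 - 2 d` (`exists_autocovariance_le`), and `l_t` is in `L^{1/a}` as long as
  `-β < a < 1 - β` (`integrable_abs_fracFilter_rpow`). The hypotheses on `d` and `β`
  say precisely that `b` and `a` can be chosen so that Young's inequality applies
  (`exists_exponents`). Only finiteness is needed, so the pointwise inequality `mul_mul_le_young` behind Young's inequality suffices.
* **The kernel.** By Fubini, finiteness of `V` gives absolute convergence of `h_t` almost everywhere
  and `h_t ∈ L²` with `‖h_t‖² = V t` (`integral_kernel_sq`).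
* **Covariance.** Since `h_t - h_s` is a translate of `h_{t - s}`, polarization expresses
  `⟨h_t, h_s⟩` by `V` (`integral_kernel_mul`), and scaling `u` and `v` by `τ` identifies `k! V τ`
  with `C_τ τ ^ (2 β + 2 + k (d - 1/2))` (`covConst_mul_rpow`).
* **The Wiener–Itô isometry** `E (I_k f · I_k g) = k! ⟨f, g⟩` for symmetric `g`
  (`integral_wienerItoIntegral_mul`) transfers this to the process. It holds on off-diagonal step
  functions by the moment formula `IsWhiteNoise.integral_prod_mul_prod`, extends to the closed graph
  by continuity, and the graph is defined over all of `L²` because off-diagonal step functions are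
  dense (`dense_stepGraph_fst`).
-/

open MeasureTheory ProbabilityTheory
open scoped ENNReal

noncomputable section

namespace TemperedHermite

/-! ### Moments of white noise -/

section WhiteNoise

variable {Ω : Type*} [MeasurableSpace Ω] {P : Measure Ω} {W : FinMeasSet → Ω → ℝ}

theorem IsWhiteNoise.memLp (hW : IsWhiteNoise W P) (A : FinMeasSet) {p : ℝ≥0∞} (hp : p ≠ ∞) :
    MemLp (W A) p P :=
  (hW.isGaussianProcess.hasGaussianLaw_eval A).memLp hp

theorem IsWhiteNoise.memLp_prod (hW : IsWhiteNoise W P) {ι : Type*} [Fintype ι]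
    (A : ι → FinMeasSet) {p : ℝ≥0∞} (hp : p ≠ ∞) :
    MemLp (fun ω => ∏ i, W (A i) ω) p P := by
  have := hW.isGaussianProcess.isProbabilityMeasure
  refine (MemLp.prod' (s := Finset.univ) (f := fun i => W (A i))
    (p := fun _ => p * (Fintype.card ι : ℝ≥0∞)) fun i _ =>
      hW.memLp (A i) (ENNReal.mul_ne_top hp (ENNReal.natCast_ne_top _))).mono_exponent ?_
  simp only [Finset.sum_const, Finset.card_univ, nsmul_eq_mul]
  rcases eq_or_ne p 0 with rfl | h0
  · simp
  rcases Nat.eq_zero_or_pos (Fintype.card ι) with h | h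
  · simp [h]
  have h1 : (Fintype.card ι : ℝ≥0∞) ≠ 0 := by simpa using h.ne'
  rw [ENNReal.mul_inv (Or.inl h0) (Or.inl hp), mul_left_comm,
    ENNReal.mul_inv_cancel h1 (ENNReal.natCast_ne_top _), mul_one, inv_inv]

theorem IsWhiteNoise.integrable_mul (hW : IsWhiteNoise W P) (A B : FinMeasSet) :
    Integrable (fun ω => W A ω * W B ω) P :=
  (hW.memLp A (p := 2) (by simp)).integrable_mul (hW.memLp B (p := 2) (by simp))

/-- White noise is finitely additive almost surely: the difference of the two sides has second
moment zero. -/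
theorem IsWhiteNoise.ae_eq_sum (hW : IsWhiteNoise W P) {ι : Type*} [Fintype ι]
    (C : FinMeasSet) (E : ι → FinMeasSet) (hE : ∀ i j, i ≠ j → Disjoint (E i).1 (E j).1)
    (hC : C.1 = ⋃ i, (E i).1) : W C =ᵐ[P] fun ω => ∑ i, W (E i) ω := by
  classical
  have hsub : ∀ i, (E i).1 ⊆ C.1 := fun i => hC ▸ Set.subset_iUnion (fun i => (E i).1) i
  have hi1 : Integrable (fun ω => W C ω * W C ω) P := hW.integrable_mul C C
  have hi2 : Integrable (fun ω => ∑ i, W C ω * W (E i) ω) P :=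
    integrable_finsetSum _ fun i _ => hW.integrable_mul C (E i)
  have hi3 : Integrable (fun ω => ∑ i, ∑ j, W (E i) ω * W (E j) ω) P :=
    integrable_finsetSum _ fun i _ => integrable_finsetSum _ fun j _ => hW.integrable_mul _ _
  have hexp : ∀ ω, (W C ω - ∑ i, W (E i) ω) ^ 2 =
      W C ω * W C ω - 2 * ∑ i, W C ω * W (E i) ω + ∑ i, ∑ j, W (E i) ω * W (E j) ω := by
    intro ω
    rw [← Finset.mul_sum, ← Finset.sum_mul_sum]
    ring
  have hvol : volume.real C.1 = ∑ i, volume.real (E i).1 := by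
    rw [hC]
    exact measureReal_iUnion_fintype (fun i j h => hE i j h) (fun i => (E i).2.1)
      (fun i => (E i).2.2)
  have hi12 : Integrable (fun ω => W C ω * W C ω - 2 * ∑ i, W C ω * W (E i) ω) P :=
    hi1.sub (hi2.const_mul 2)
  have hint : Integrable (fun ω => (W C ω - ∑ i, W (E i) ω) ^ 2) P := by
    simp_rw [hexp]
    exact hi12.add hi3
  have hzero : ∫ ω, (W C ω - ∑ i, W (E i) ω) ^ 2 ∂P = 0 := by
    simp_rw [hexp]
    rw [integral_add hi12 hi3, integral_sub hi1 (hi2.const_mul 2),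
      integral_const_mul, integral_finsetSum _ fun i _ => hW.integrable_mul C (E i),
      integral_finsetSum _ fun i _ => integrable_finsetSum _ fun j _ => hW.integrable_mul _ _]
    simp_rw [integral_finsetSum _ fun j _ => hW.integrable_mul _ _, hW.covariance_eq]
    have h1 : ∀ i, volume.real (C.1 ∩ (E i).1) = volume.real (E i).1 := fun i => by
      rw [Set.inter_eq_self_of_subset_right (hsub i)]
    have h2 : ∀ i, ∑ j, volume.real ((E i).1 ∩ (E j).1) = volume.real (E i).1 := fun i => by
      rw [Finset.sum_eq_single i]
      · rw [Set.inter_self]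
      · intro j _ hj
        rw [(hE i j hj.symm).inter_eq, measureReal_empty]
      · simp
    simp_rw [h1, h2, Set.inter_self, hvol]
    ring
  have h := (integral_eq_zero_iff_of_nonneg (fun ω => sq_nonneg _) hint).1 hzero
  filter_upwards [h] with ω hω
  simpa [sub_eq_zero] using hω

/-- White noise of a set is independent of the white noise of the sets disjoint from it. -/
theorem IsWhiteNoise.integral_pow_mul (hW : IsWhiteNoise W P) {ι : Type*} [Finite ι]
    (C : FinMeasSet) (D : ι → FinMeasSet) (h : ∀ l, Disjoint C.1 (D l).1) (m : ℕ)
    {F : (ι → ℝ) → ℝ} (hF : Measurable F) :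
    ∫ ω, W C ω ^ m * F (fun l => W (D l) ω) ∂P =
      (∫ ω, W C ω ^ m ∂P) * ∫ ω, F (fun l => W (D l) ω) ∂P := by
  have := hW.isGaussianProcess.isProbabilityMeasure
  have hG : IsGaussianProcess (Sum.elim (fun _ : Unit => W C) (fun l => W (D l))) P := by
    have : Sum.elim (fun _ : Unit => W C) (fun l => W (D l)) =
        W ∘ Sum.elim (fun _ : Unit => C) D := by
      ext x
      cases x <;> rfl
    rw [this]
    exact hW.isGaussianProcess.comp_right _
  have hind := hG.indepFun_of_covariance_eq_zero (fun _ => hW.isGaussianProcess.aemeasurable C)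
    (fun l => hW.isGaussianProcess.aemeasurable (D l)) fun _ l => by
      rw [covariance_eq_sub (hW.memLp C (by simp)) (hW.memLp (D l) (by simp)),
        hW.mean_eq_zero, zero_mul, sub_zero]
      simpa [(h l).inter_eq] using hW.covariance_eq C (D l)
  have hind2 := hind.comp (φ := fun x : Unit → ℝ => x () ^ m) (ψ := F)
    ((measurable_pi_apply (X := fun _ : Unit => ℝ) ()).pow_const m) hF
  refine hind2.integral_fun_mul_eq_mul_integral ?_ ?_
  · exact ((hW.isGaussianProcess.aemeasurable C).pow_const m).aestronglyMeasurable
  · exact (hF.comp_aemeasurable (aemeasurable_pi_lambda _ fun l =>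
      hW.isGaussianProcess.aemeasurable (D l))).aestronglyMeasurable

theorem FinMeasSet.inter_mem (A : FinMeasSet) {B : Set ℝ} (hB : MeasurableSet B) :
    MeasurableSet (A.1 ∩ B) ∧ volume (A.1 ∩ B) ≠ ∞ :=
  ⟨A.2.1.inter hB, measure_ne_top_of_subset Set.inter_subset_left A.2.2⟩

/-- A permutation of `Fin (n + 1)` is determined by the image of `0` and a permutation of
`Fin n`; this is the resulting expansion of a sum over permutations along its first row. -/
theorem sum_perm_fin_succ {n : ℕ} (M : Fin (n + 1) → Fin (n + 1) → ℝ) :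
    ∑ σ : Equiv.Perm (Fin (n + 1)), ∏ i, M i (σ i) =
      ∑ j, M 0 j * ∑ σ : Equiv.Perm (Fin n), ∏ i, M i.succ (Equiv.swap 0 j (σ i).succ) := by
  rw [← Equiv.sum_comp Equiv.Perm.decomposeFin.symm, Fintype.sum_prod_type]
  refine Finset.sum_congr rfl fun j _ => ?_
  rw [Finset.mul_sum]
  refine Finset.sum_congr rfl fun σ _ => ?_
  rw [Fin.prod_univ_succ]
  simp

/-- The special case of the Isserlis formula that the Wiener–Itô isometry rests on. Within each of
the two families the variables are independent, so only pairings between the families survive.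
The set `A 0` is split along the sets `B j`; the part outside all of them contributes nothing,
and the part inside `B j` can only be paired with itself. -/
theorem IsWhiteNoise.integral_prod_mul_prod (hW : IsWhiteNoise W P) {n : ℕ}
    (A B : Fin n → FinMeasSet) (hA : ∀ i j, i ≠ j → Disjoint (A i).1 (A j).1)
    (hB : ∀ i j, i ≠ j → Disjoint (B i).1 (B j).1) :
    ∫ ω, (∏ i, W (A i) ω) * ∏ j, W (B j) ω ∂P =
      ∑ σ : Equiv.Perm (Fin n), ∏ i, volume.real ((A i).1 ∩ (B (σ i)).1) := by
  have := hW.isGaussianProcess.isProbabilityMeasure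
  induction n with
  | zero => simp
  | succ n ih =>
    let D : FinMeasSet := ⟨(A 0).1 ∩ (⋃ j, (B j).1)ᶜ,
      (A 0).inter_mem (MeasurableSet.iUnion fun j => (B j).2.1).compl⟩
    let E : Fin (n + 1) → FinMeasSet := fun j => ⟨(A 0).1 ∩ (B j).1, (A 0).inter_mem (B j).2.1⟩
    let R : Fin (n + 1) → FinMeasSet := fun j =>
      ⟨(B j).1 ∩ ((A 0).1)ᶜ, (B j).inter_mem (A 0).2.1.compl⟩
    have hsplit : W (A 0) =ᵐ[P] fun ω => W D ω + ∑ j, W (E j) ω := by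
      have h := hW.ae_eq_sum (A 0) (fun o : Option (Fin (n + 1)) => o.elim D E) (by
        rintro (_ | i) (_ | j) hij
        · exact absurd rfl hij
        · exact Set.disjoint_left.2 fun x hx hx' => hx.2 (Set.mem_iUnion.2 ⟨j, hx'.2⟩)
        · exact Set.disjoint_left.2 fun x hx hx' => hx'.2 (Set.mem_iUnion.2 ⟨i, hx.2⟩)
        · exact (hB i j (by simpa using hij)).mono Set.inter_subset_right Set.inter_subset_right)
        (by
          ext x
          simp only [Set.mem_iUnion, Option.exists, Option.elim, D, E, Set.mem_inter_iff,
            Set.mem_compl_iff, not_exists]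
          by_cases hx : ∃ j, x ∈ (B j).1 <;> grind)
      simpa [Fintype.sum_option] using h
    have hrest : ∀ j, W (B j) =ᵐ[P] fun ω => W (E j) ω + W (R j) ω := fun j => by
      have h := hW.ae_eq_sum (B j) (fun b : Bool => if b then E j else R j) (by
        rintro (_ | _) (_ | _) hij
        · exact absurd rfl hij
        · exact Set.disjoint_left.2 fun x hx hx' => hx.2 hx'.1
        · exact Set.disjoint_left.2 fun x hx hx' => hx'.2 hx.1
        · exact absurd rfl hij)
        (by
          ext x
          simp only [Set.mem_iUnion, Bool.exists_bool, E, R]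
          by_cases hx : x ∈ (A 0).1 <;> simp [hx])
      simpa using h
    -- the variables that remain after `A 0` has been paired with `B j`
    let B' : Fin (n + 1) → Fin n → FinMeasSet := fun j i => B (Equiv.swap 0 j i.succ)
    let G : Fin (n + 1) → Ω → ℝ := fun j ω => (∏ i : Fin n, W (A i.succ) ω) * ∏ i, W (B' j i) ω
    have hperm : ∀ j ω, ∏ i, W (B i) ω = W (B j) ω * ∏ i, W (B' j i) ω := fun j ω => by
      rw [← Equiv.prod_comp (Equiv.swap 0 j), Fin.prod_univ_succ, Equiv.swap_apply_left]
    have hB'ne : ∀ j (i : Fin n), Equiv.swap 0 j i.succ ≠ j := fun j i h => by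
      have := (Equiv.swap 0 j).injective (h.trans (Equiv.swap_apply_left 0 j).symm)
      exact Fin.succ_ne_zero i this
    have hm : ∀ {ι : Type} [Fintype ι], Measurable fun x : ι → ℝ => ∏ i, x i := fun {ι} _ =>
      Finset.measurable_fun_prod _ fun i _ => measurable_pi_apply i
    have hDterm : ∫ ω, W D ω * ((∏ i : Fin n, W (A i.succ) ω) * ∏ j, W (B j) ω) ∂P = 0 := by
      have h := hW.integral_pow_mul D
        (Sum.elim (fun i : Fin n => A i.succ) B) (by
          rintro (i | j)
          · exact (hA 0 i.succ (Fin.succ_ne_zero i).symm).mono_left Set.inter_subset_left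
          · exact Set.disjoint_left.2 fun x hx hx' => hx.2 (Set.mem_iUnion.2 ⟨j, hx'⟩)) 1 hm
      simpa [Fintype.prod_sum_type, hW.mean_eq_zero] using h
    have hEterm : ∀ j, ∫ ω, W (E j) ω * ((∏ i : Fin n, W (A i.succ) ω) * ∏ j, W (B j) ω) ∂P =
        volume.real ((A 0).1 ∩ (B j).1) * ∫ ω, G j ω ∂P := fun j => by
      have hdis : ∀ l : Fin n ⊕ Fin n, Disjoint (E j).1
          (Sum.elim (fun i : Fin n => A i.succ) (B' j) l).1 := by
        rintro (i | i)
        · exact (hA 0 i.succ (Fin.succ_ne_zero i).symm).mono_left Set.inter_subset_left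
        · exact (hB j _ (hB'ne j i).symm).mono_left Set.inter_subset_right
      have h1 := hW.integral_pow_mul (E j) _ hdis 2 hm
      have h2 := hW.integral_pow_mul (E j)
        (fun o : Option (Fin n ⊕ Fin n) =>
          o.elim (R j) (Sum.elim (fun i : Fin n => A i.succ) (B' j)))
        (by
          rintro (_ | l)
          · exact Set.disjoint_left.2 fun x hx hx' => hx'.2 hx.1
          · exact hdis l) 1 hm
      have hsq : ∫ ω, W (E j) ω ^ 2 ∂P = volume.real ((A 0).1 ∩ (B j).1) := by
        simpa [sq, E] using hW.covariance_eq (E j) (E j)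
      simp only [Fintype.prod_sum_type, Fintype.prod_option, Option.elim, Sum.elim_inl,
        Sum.elim_inr, pow_one, hW.mean_eq_zero, zero_mul] at h1 h2
      have hi1 : Integrable (fun ω => W (E j) ω ^ 2 * G j ω) P := by
        have := (hW.memLp_prod (fun l : (Unit ⊕ Unit) ⊕ (Fin n ⊕ Fin n) => Sum.elim
          (fun _ => E j) (Sum.elim (fun i : Fin n => A i.succ) (B' j)) l) (p := 1)
          (by simp)).integrable le_rfl
        simpa [Fintype.prod_sum_type, sq, G] using this
      have hi2 : Integrable (fun ω => W (E j) ω * (W (R j) ω * G j ω)) P := by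
        have := (hW.memLp_prod (fun l : (Unit ⊕ Unit) ⊕ (Fin n ⊕ Fin n) => Sum.elim
          (Sum.elim (fun _ => E j) (fun _ => R j))
          (Sum.elim (fun i : Fin n => A i.succ) (B' j)) l) (p := 1)
          (by simp)).integrable le_rfl
        simpa [Fintype.prod_sum_type, mul_assoc, G] using this
      have hae : (fun ω => W (E j) ω * ((∏ i : Fin n, W (A i.succ) ω) * ∏ j, W (B j) ω)) =ᵐ[P]
          fun ω => W (E j) ω ^ 2 * G j ω + W (E j) ω * (W (R j) ω * G j ω) := by
        filter_upwards [hrest j] with ω hω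
        rw [hperm j, hω]
        simp only [G]
        ring
      rw [integral_congr_ae hae, integral_add hi1 hi2, h2, add_zero, ← hsq]
      exact h1
    have hiD : ∀ C : FinMeasSet,
        Integrable (fun ω => W C ω * ((∏ i : Fin n, W (A i.succ) ω) * ∏ j, W (B j) ω)) P := by
      intro C
      have := (hW.memLp_prod (fun l : Unit ⊕ (Fin n ⊕ Fin (n + 1)) => Sum.elim
          (fun _ => C) (Sum.elim (fun i : Fin n => A i.succ) B) l) (p := 1)
          (by simp)).integrable le_rfl
      simpa [Fintype.prod_sum_type] using this
    have hae : (fun ω => (∏ i, W (A i) ω) * ∏ j, W (B j) ω) =ᵐ[P] fun ω =>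
        W D ω * ((∏ i : Fin n, W (A i.succ) ω) * ∏ j, W (B j) ω) +
          ∑ j, W (E j) ω * ((∏ i : Fin n, W (A i.succ) ω) * ∏ j, W (B j) ω) := by
      filter_upwards [hsplit] with ω hω
      rw [Fin.prod_univ_succ, hω, ← Finset.sum_mul]
      ring
    rw [integral_congr_ae hae, integral_add (hiD D) (integrable_finsetSum _ fun j _ => hiD (E j)),
      hDterm, zero_add, integral_finsetSum _ fun j _ => hiD (E j), sum_perm_fin_succ
        fun i j => volume.real ((A i).1 ∩ (B j).1)]
    refine Finset.sum_congr rfl fun j _ => ?_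
    rw [hEterm j, ih (fun i => A i.succ) (B' j)
      (fun i i' h => hA _ _ (by simpa using h))
      (fun i i' h => hB _ _ (by simpa using h))]

end WhiteNoise

/-! ### Off-diagonal step functions are dense -/

/-- The set of points with two equal coordinates is a finite union of hyperplanes. -/
theorem ae_injective (k : ℕ) : ∀ᵐ x : Fin k → ℝ, ∀ i j, i ≠ j → x i ≠ x j := by
  rw [ae_all_iff]
  intro i
  rw [ae_all_iff]
  intro j
  by_cases hij : i = j
  · simp [hij]
  let L : (Fin k → ℝ) →ₗ[ℝ] ℝ :=
    LinearMap.proj (R := ℝ) (φ := fun _ : Fin k => ℝ) i - LinearMap.proj j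
  have hL : LinearMap.ker L ≠ ⊤ := by
    intro h
    have h1 : L (Pi.single i 1) = 0 := by
      rw [← LinearMap.mem_ker, h]
      trivial
    simp [L, Ne.symm hij] at h1
  have h0 := Measure.addHaar_submodule (volume : Measure (Fin k → ℝ)) _ hL
  rw [ae_iff]
  convert h0 using 2
  ext x
  simp [L, hij, sub_eq_zero]

/-- A function integrating to zero over all measurable sub-rectangles of a box of finite volume
vanishes almost everywhere on the box. -/
theorem ae_restrict_box_eq_zero {k : ℕ} {f : (Fin k → ℝ) → ℝ} {Q : Fin k → Set ℝ}
    (hQ : ∀ i, MeasurableSet (Q i)) (hf : IntegrableOn f (Set.univ.pi Q))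
    (h : ∀ A : Fin k → Set ℝ, (∀ i, MeasurableSet (A i)) → (∀ i, A i ⊆ Q i) →
      ∫ x in Set.univ.pi A, f x = 0) :
    f =ᵐ[volume.restrict (Set.univ.pi Q)] 0 := by
  have key : ∀ s, MeasurableSet s → ∫ x in s, f x ∂volume.restrict (Set.univ.pi Q) = 0 := by
    intro s hs
    have hpi : IsPiSystem
        (Set.univ.pi '' Set.univ.pi fun _ : Fin k => {s : Set ℝ | MeasurableSet s}) :=
      isPiSystem_pi
    induction s, hs using MeasurableSpace.induction_on_inter generateFrom_pi.symm
      hpi with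
    | empty => simp
    | basic t ht =>
      obtain ⟨A, hA', rfl⟩ := ht
      have hA : ∀ i, MeasurableSet (A i) := fun i => hA' i trivial
      rw [Measure.restrict_restrict (MeasurableSet.univ_pi hA),
        ← Set.pi_inter_distrib]
      exact h _ (fun i => (hA i).inter (hQ i)) fun i => Set.inter_subset_right
    | compl t ht ih =>
      have h1 := integral_add_compl ht hf
      rw [ih, zero_add] at h1
      rw [h1]
      exact h Q hQ fun i => subset_rfl
    | iUnion t hd ht ih =>
      rw [integral_iUnion ht hd hf.integrableOn]
      simp [ih]
  exact Integrable.ae_eq_zero_of_forall_setIntegral_eq_zero hf fun s hs _ => key s hs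

/-- The off-diagonal step functions, paired with their multiple integrals. -/
def stepGraph {Ω : Type*} [MeasurableSpace Ω] (W : FinMeasSet → Ω → ℝ) (P : Measure Ω)
    (k : ℕ) : Submodule ℝ (Lp ℝ 2 (volume : Measure (Fin k → ℝ)) × Lp ℝ 2 P) :=
  Submodule.span ℝ
    {p | ∃ A : Fin k → FinMeasSet,
      (∀ i j, i ≠ j → Disjoint (A i).1 (A j).1) ∧
      (p.1 =ᵐ[volume] (Set.univ.pi fun i => (A i).1).indicator fun _ => (1 : ℝ)) ∧
      (p.2 =ᵐ[P] fun ω => ∏ i, W (A i) ω)}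

section WhiteNoise

variable {Ω : Type*} [MeasurableSpace Ω] {P : Measure Ω} {W : FinMeasSet → Ω → ℝ} {k : ℕ}

theorem measurableSet_rect (A : Fin k → FinMeasSet) :
    MeasurableSet (Set.univ.pi fun i => (A i).1) :=
  MeasurableSet.univ_pi fun i => (A i).2.1

theorem volume_rect_ne_top (A : Fin k → FinMeasSet) :
    volume (Set.univ.pi fun i => (A i).1) ≠ ∞ := by
  rw [volume_pi_pi]
  exact ENNReal.prod_ne_top fun i _ => (A i).2.2

/-- A function orthogonal to all off-diagonal rectangles vanishes on every box with disjoint sides;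
these boxes cover all points off the diagonals. -/
theorem dense_stepGraph_fst (hW : IsWhiteNoise W P) :
    ((stepGraph W P k).map (LinearMap.fst ℝ _ _)).topologicalClosure = ⊤ := by
  rw [Submodule.topologicalClosure_eq_top_iff, Submodule.eq_bot_iff]
  intro f hf
  have hrect : ∀ A : Fin k → FinMeasSet, (∀ i j, i ≠ j → Disjoint (A i).1 (A j).1) →
      ∫ x in Set.univ.pi fun i => (A i).1, f x = 0 := fun A hA => by
    have hX := hW.memLp_prod A (p := 2) (by simp)
    rw [← L2.inner_indicatorConstLp_one (𝕜 := ℝ) (measurableSet_rect A) (volume_rect_ne_top A) f]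
    refine (Submodule.mem_orthogonal _ f).1 hf _
      ⟨⟨indicatorConstLp 2 (measurableSet_rect A) (volume_rect_ne_top A) (1 : ℝ),
       hX.toLp _⟩,
      Submodule.subset_span ⟨A, hA, ?_, MemLp.coeFn_toLp hX⟩, rfl⟩
    exact indicatorConstLp_coeFn (hs := measurableSet_rect A) (hμs := volume_rect_ne_top A)
  rw [Lp.eq_zero_iff_ae_eq_zero]
  have hnull : volume {x : Fin k → ℝ | (∀ i j, i ≠ j → x i ≠ x j) ∧ f x ≠ 0} = 0 := by
    refine measure_null_of_locally_null _ fun x hx => ?_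
    have hε : ∀ᶠ ε : ℝ in nhdsWithin 0 (Set.Ioi 0), ∀ i j, i ≠ j → 2 * ε < |x i - x j| := by
      rw [Filter.eventually_all]
      intro i
      rw [Filter.eventually_all]
      intro j
      by_cases hij : i = j
      · simp [hij]
      have hpos : 0 < |x i - x j| := abs_pos.2 (sub_ne_zero.2 (hx.1 i j hij))
      have : Filter.Tendsto (fun ε : ℝ => 2 * ε) (nhdsWithin 0 (Set.Ioi 0)) (nhds 0) := by
        have h : Filter.Tendsto (fun ε : ℝ => 2 * ε) (nhds 0) (nhds (2 * 0)) :=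
          (continuous_const.mul continuous_id).tendsto 0
        rw [mul_zero] at h
        exact h.mono_left nhdsWithin_le_nhds
      filter_upwards [this.eventually_lt_const hpos] with ε hε _ using hε
    obtain ⟨ε, hε, hε0⟩ := (hε.and self_mem_nhdsWithin).exists
    let Q : Fin k → Set ℝ := fun i => Set.Ioo (x i - ε) (x i + ε)
    have hQfin : ∀ i, volume (Q i) ≠ ∞ := fun i => by simp [Q, Real.volume_Ioo]
    have hQvol : volume (Set.univ.pi Q) ≠ ∞ :=
      volume_rect_ne_top fun i => ⟨Q i, measurableSet_Ioo, hQfin i⟩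
    have hQd : ∀ i j, i ≠ j → Disjoint (Q i) (Q j) := fun i j hij => by
      refine Set.disjoint_left.2 fun y hy hy' => ?_
      have h1 := hε i j hij
      simp only [Q, Set.mem_Ioo] at hy hy'
      rcases lt_abs.1 h1 with h | h <;> linarith
    have hzero := ae_restrict_box_eq_zero (f := f) (Q := Q) (fun i => measurableSet_Ioo)
      (integrableOn_Lp_of_measure_ne_top f (by simp) hQvol) fun A hA hAQ =>
        hrect (fun i => ⟨A i, hA i, measure_ne_top_of_subset (hAQ i) (hQfin i)⟩)
          fun i j hij => (hQd i j hij).mono (hAQ i) (hAQ j)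
    rw [Filter.EventuallyEq, ae_restrict_iff' (MeasurableSet.univ_pi fun i => measurableSet_Ioo),
      ae_iff] at hzero
    refine ⟨_, Filter.inter_mem self_mem_nhdsWithin (nhdsWithin_le_nhds
      (set_pi_mem_nhds (s := Q) Set.finite_univ fun i _ => Ioo_mem_nhds ?_ ?_)),
      measure_mono_null ?_ hzero⟩
    · simpa using hε0
    · simpa using hε0
    · rintro y ⟨hy, hyQ⟩ h
      exact hy.2 (h hyQ)
  filter_upwards [ae_injective k, measure_eq_zero_iff_ae_notMem.1 hnull] with x hx hx'
  by_contra h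
  exact hx' ⟨hx, h⟩

/-! ### The Wiener–Itô isometry -/

theorem measurePreserving_perm (σ : Equiv.Perm (Fin k)) :
    MeasurePreserving (fun (x : Fin k → ℝ) i => x (σ i)) volume volume := by
  convert! volume_measurePreserving_piCongrLeft (fun _ : Fin k => ℝ) σ.symm using 1
  ext x i
  have h := MeasurableEquiv.piCongrLeft_apply_apply (β := fun _ : Fin k => ℝ) σ.symm x (σ i)
  rw [Equiv.symm_apply_apply] at h
  exact h.symm

/-- The sum of the `k!` permutations of the variables; up to the factor `k!` this is the
symmetrization of a function in `L²(ℝᵏ)`. -/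
def permSum (k : ℕ) : Lp ℝ 2 (volume : Measure (Fin k → ℝ)) →L[ℝ]
    Lp ℝ 2 (volume : Measure (Fin k → ℝ)) :=
  ∑ σ : Equiv.Perm (Fin k),
    (Lp.compMeasurePreservingₗᵢ ℝ _ (measurePreserving_perm σ)).toContinuousLinearMap

theorem bilin_eq_zero_of_mem_closedSpan {E : Type*} [NormedAddCommGroup E] [NormedSpace ℝ E]
    (B : E →L[ℝ] E →L[ℝ] ℝ) (S : Set E) (h : ∀ p ∈ S, ∀ q ∈ S, B p q = 0) :
    ∀ p ∈ (Submodule.span ℝ S).topologicalClosure, ∀ q ∈ (Submodule.span ℝ S).topologicalClosure,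
      B p q = 0 := by
  have h1 : ∀ p ∈ S, ∀ q ∈ (Submodule.span ℝ S).topologicalClosure, B p q = 0 := fun p hp q hq =>
    Submodule.topologicalClosure_minimal (t := (B p).ker) _
      (Submodule.span_le.2 fun q hq => h p hp q hq)
      (B p).isClosed_ker hq
  intro p hp q hq
  exact Submodule.topologicalClosure_minimal (t := (B.flip q).ker) _
    (Submodule.span_le.2 fun p hp => h1 p hp q hq) (B.flip q).isClosed_ker hp

/-- The bilinear form `(p, q) ↦ ⟨p.2, q.2⟩ - ∑ σ, ⟨p.1, q.1 ∘ σ⟩`, whose vanishing on the graph is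
the isometry. -/
def isometryDefect (P : Measure Ω) (k : ℕ) :
    (Lp ℝ 2 (volume : Measure (Fin k → ℝ)) × Lp ℝ 2 P) →L[ℝ]
      (Lp ℝ 2 (volume : Measure (Fin k → ℝ)) × Lp ℝ 2 P) →L[ℝ] ℝ :=
  (innerSL ℝ).bilinearComp (ContinuousLinearMap.snd ℝ _ _) (ContinuousLinearMap.snd ℝ _ _) -
    (innerSL ℝ).bilinearComp (ContinuousLinearMap.fst ℝ _ _)
      (permSum k ∘L ContinuousLinearMap.fst ℝ _ _)

theorem inner_snd_eq (hW : IsWhiteNoise W P) {p q} (hp : p ∈ wienerItoGraph W P k)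
    (hq : q ∈ wienerItoGraph W P k) :
    inner ℝ p.2 q.2 = inner ℝ p.1 (permSum k q.1) := by
  rw [← sub_eq_zero]
  refine bilin_eq_zero_of_mem_closedSpan (isometryDefect P k) _ ?_ p hp q hq
  rintro ⟨f, X⟩ ⟨A, hA, hf, hX⟩ ⟨g, Y⟩ ⟨B, hB, hg, hY⟩
  classical
  have hperm : ∀ σ : Equiv.Perm (Fin k), inner ℝ f (Lp.compMeasurePreserving _
      (measurePreserving_perm σ) g) = ∏ i, volume.real ((A i).1 ∩ (B (σ⁻¹ i)).1) := fun σ => by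
    have h1 : (fun x => inner ℝ (f x) (Lp.compMeasurePreserving _ (measurePreserving_perm σ) g x))
        =ᵐ[volume] (Set.univ.pi fun i => (A i).1 ∩ (B (σ⁻¹ i)).1).indicator fun _ => (1 : ℝ) := by
      filter_upwards [hf, Lp.coeFn_compMeasurePreserving g (measurePreserving_perm σ),
        (measurePreserving_perm σ).quasiMeasurePreserving.ae_eq_comp hg] with x h2 h3 h4
      rw [h2, h3, h4]
      have h5 : (fun i => x (σ i)) ∈ (Set.univ.pi fun i => (B i).1) ↔
          x ∈ Set.univ.pi fun i => (B (σ⁻¹ i)).1 := by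
        simp only [Set.mem_univ_pi]
        exact ⟨fun h i => by simpa using h (σ⁻¹ i), fun h i => by simpa using h (σ i)⟩
      simp only [Function.comp_apply, Set.indicator_apply, h5, Set.pi_inter_distrib,
        Set.mem_inter_iff]
      by_cases h6 : x ∈ Set.univ.pi fun i => (A i).1 <;>
        by_cases h7 : x ∈ Set.univ.pi fun i => (B (σ⁻¹ i)).1 <;> simp [h6]
    rw [L2.inner_def, integral_congr_ae h1, integral_indicator_const _
      (MeasurableSet.univ_pi fun i => (A i).2.1.inter (B (σ⁻¹ i)).2.1), smul_eq_mul, mul_one,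
      measureReal_def, volume_pi_pi, ENNReal.toReal_prod]
    rfl
  have hX2 : inner ℝ X Y =
      ∑ σ : Equiv.Perm (Fin k), ∏ i, volume.real ((A i).1 ∩ (B (σ i)).1) := by
    rw [← hW.integral_prod_mul_prod A B hA hB, L2.inner_def]
    refine integral_congr_ae ?_
    filter_upwards [hX, hY] with ω h1 h2
    rw [h1, h2]
    simp [mul_comm]
  change inner ℝ X Y - inner ℝ f (permSum k g) = 0
  rw [hX2, sub_eq_zero, permSum, _root_.sum_apply, inner_sum,
    ← Equiv.sum_comp (Equiv.inv (Equiv.Perm (Fin k)))]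
  exact Finset.sum_congr rfl fun σ _ => (hperm σ).symm

/-- The domain of the graph is closed, because the isometry bounds the second component by the
first one, and dense; so the multiple integral is defined on all of `L²(ℝᵏ)`. -/
theorem exists_mem_wienerItoGraph (hW : IsWhiteNoise W P)
    (f : Lp ℝ 2 (volume : Measure (Fin k → ℝ))) : ∃ X, (f, X) ∈ wienerItoGraph W P k := by
  let L : wienerItoGraph W P k →L[ℝ] Lp ℝ 2 (volume : Measure (Fin k → ℝ)) :=
    ContinuousLinearMap.fst ℝ _ _ ∘L (wienerItoGraph W P k).subtypeL
  have : CompleteSpace (wienerItoGraph W P k) :=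
    (Submodule.isClosed_topologicalClosure _).completeSpace_coe
  obtain ⟨K, hK⟩ : ∃ K : NNReal, ∀ p, ‖p‖ ≤ K * ‖L p‖ := by
    refine ⟨1 + NNReal.sqrt ‖permSum k‖₊, fun p => ?_⟩
    have h1 : ‖p.1.2‖ ^ 2 ≤ ‖permSum k‖ * ‖p.1.1‖ ^ 2 := by
      rw [← real_inner_self_eq_norm_sq, inner_snd_eq hW p.2 p.2]
      calc _ ≤ ‖p.1.1‖ * ‖permSum k p.1.1‖ := real_inner_le_norm _ _
        _ ≤ ‖p.1.1‖ * (‖permSum k‖ * ‖p.1.1‖) := by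
          gcongr
          exact (permSum k).le_opNorm _
        _ = _ := by ring
    have h2 : ‖p.1.2‖ ≤ Real.sqrt ‖permSum k‖ * ‖p.1.1‖ := by
      have := Real.sqrt_le_sqrt h1
      rwa [Real.sqrt_sq (norm_nonneg _), Real.sqrt_mul (norm_nonneg _),
        Real.sqrt_sq (norm_nonneg _)] at this
    have h3 : ‖p‖ ≤ ‖p.1.1‖ + ‖p.1.2‖ := by
      rw [Submodule.coe_norm, Prod.norm_def]
      exact max_le_add_of_nonneg (norm_nonneg _) (norm_nonneg _)
    have h4 : L p = p.1.1 := rfl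
    rw [h4]
    push_cast
    linarith
  have hclosed : IsClosed (Set.range L) :=
    (L.antilipschitz_of_bound hK).isClosed_range L.uniformContinuous
  have htop : (⊤ : Submodule ℝ (Lp ℝ 2 (volume : Measure (Fin k → ℝ)))) ≤ L.range := by
    rw [← dense_stepGraph_fst hW]
    refine Submodule.topologicalClosure_minimal _ ?_ hclosed
    rintro _ ⟨p, hp, rfl⟩
    exact ⟨⟨p, Submodule.le_topologicalClosure _ hp⟩, rfl⟩
  obtain ⟨p, hp⟩ := htop (Submodule.mem_top (x := f))
  refine ⟨p.1.2, ?_⟩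
  rw [← hp]
  exact p.2

/-- The Wiener–Itô isometry when one of the two kernels is symmetric. -/
theorem integral_wienerItoIntegral_mul (hW : IsWhiteNoise W P) {f g : (Fin k → ℝ) → ℝ}
    (hf : MemLp f 2) (hg : MemLp g 2)
    (hsymm : ∀ (σ : Equiv.Perm (Fin k)) x, g (fun i => x (σ i)) = g x) :
    ∫ ω, wienerItoIntegral W P k f ω * wienerItoIntegral W P k g ω ∂P =
      k.factorial * ∫ x, f x * g x := by
  have hex : ∀ {f : (Fin k → ℝ) → ℝ}, MemLp f 2 →
      ∃ p ∈ wienerItoGraph W P k, p.1 =ᵐ[volume] f := fun {f} hf => by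
    obtain ⟨X, hX⟩ := exists_mem_wienerItoGraph hW (hf.toLp f)
    exact ⟨_, hX, hf.coeFn_toLp⟩
  have hF := hex hf
  have hG := hex hg
  rw [wienerItoIntegral, wienerItoIntegral, dif_pos hF, dif_pos hG]
  obtain ⟨hF1, hF2⟩ := hF.choose_spec
  obtain ⟨hG1, hG2⟩ := hG.choose_spec
  have h := inner_snd_eq hW hF1 hG1
  have hperm : permSum k hG.choose.1 = (k.factorial : ℝ) • hG.choose.1 := by
    have hσ : ∀ σ : Equiv.Perm (Fin k),
        Lp.compMeasurePreserving _ (measurePreserving_perm σ) hG.choose.1 = hG.choose.1 :=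
      fun σ => by
        refine Lp.ext ?_
        filter_upwards [hG2, Lp.coeFn_compMeasurePreserving hG.choose.1 (measurePreserving_perm σ),
          (measurePreserving_perm σ).quasiMeasurePreserving.ae_eq_comp hG2] with x h1 h2 h3
        rw [h1, h2, h3, Function.comp_apply, hsymm]
    rw [permSum, _root_.sum_apply]
    calc _ = ∑ _σ : Equiv.Perm (Fin k), hG.choose.1 := Finset.sum_congr rfl fun σ _ => hσ σ
      _ = _ := by
        rw [Finset.sum_const, Finset.card_univ, Fintype.card_perm, Fintype.card_fin,
          Nat.cast_smul_eq_nsmul]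
  generalize hF.choose = p at *
  generalize hG.choose = q at *
  rw [hperm, inner_smul_right, L2.inner_def, L2.inner_def] at h
  simp only [RCLike.inner_apply, conj_trivial] at h
  simp only [mul_comm (p.2 _), h]
  congr 1
  refine integral_congr_ae ?_
  filter_upwards [hF2, hG2] with x h2 h3
  rw [h2, h3, mul_comm]

end WhiteNoise

/-! ### Integral representations of the Bessel function -/

/-- The factor `exp (s / 2)` may be replaced by its even part `cosh (s / 2)`, which makes the
integrand the derivative of an error function of `sinh (s / 2)`. -/
theorem lintegral_exp_half_mul_exp_cosh {c : ℝ} (hc : 0 < c) :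
    ∫⁻ s : ℝ, ENNReal.ofReal (Real.exp (s / 2) * Real.exp (-(2 * c * Real.cosh s))) =
      ENNReal.ofReal (Real.sqrt (Real.pi / c) * Real.exp (-(2 * c))) := by
  set I := ∫⁻ s : ℝ, ENNReal.ofReal (Real.exp (s / 2) * Real.exp (-(2 * c * Real.cosh s))) with hI
  have hmeas : ∀ e : ℝ, Measurable fun s : ℝ =>
      ENNReal.ofReal (Real.exp (e * s / 2) * Real.exp (-(2 * c * Real.cosh s))) := fun e => by
    fun_prop
  have hneg : I =
      ∫⁻ s : ℝ, ENNReal.ofReal (Real.exp (-s / 2) * Real.exp (-(2 * c * Real.cosh s))) := by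
    rw [hI, ← lintegral_neg_eq_self]
    simp
  -- substitute `q = sinh (s / 2)`, for which `cosh s = 1 + 2 q ^ 2`
  have hsub := lintegral_image_eq_lintegral_abs_deriv_mul (s := Set.univ)
    (f := fun s => Real.sinh (s / 2)) (f' := fun s => Real.cosh (s / 2) * (1 / 2))
    MeasurableSet.univ
    (fun s _ => ((hasDerivAt_id' s).div_const 2).sinh.hasDerivWithinAt)
    (fun a _ b _ h => by have := Real.sinh_injective h; linarith)
    (fun q => ENNReal.ofReal (Real.exp (-(4 * c) * q ^ 2) * (4 * Real.exp (-(2 * c)))))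
  have hrange : (fun s => Real.sinh (s / 2)) '' Set.univ = Set.univ := by
    rw [Set.image_univ, Set.range_eq_univ]
    intro y
    exact ⟨2 * Real.arsinh y, by simp [Real.sinh_arsinh]⟩
  rw [hrange] at hsub
  simp only [Measure.restrict_univ] at hsub
  have h2 : I + I = ENNReal.ofReal (2 * (Real.sqrt (Real.pi / c) * Real.exp (-(2 * c)))) := by
    calc I + I = ∫⁻ s : ℝ, ENNReal.ofReal |Real.cosh (s / 2) * (1 / 2)| *
          ENNReal.ofReal (Real.exp (-(4 * c) * Real.sinh (s / 2) ^ 2) *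
            (4 * Real.exp (-(2 * c)))) := by
          nth_rewrite 2 [hneg]
          rw [hI, ← lintegral_add_left (by simpa using hmeas 1)]
          refine lintegral_congr fun s => ?_
          rw [← ENNReal.ofReal_add (by positivity) (by positivity),
            ← ENNReal.ofReal_mul (abs_nonneg _), abs_of_pos (by positivity)]
          congr 1
          have h1 : Real.cosh s = 1 + 2 * Real.sinh (s / 2) ^ 2 := by
            have := Real.cosh_two_mul (s / 2)
            rw [mul_div_cancel₀ s two_ne_zero, Real.cosh_sq] at this
            linarith
          have h3 : Real.exp (-(2 * c * Real.cosh s)) =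
              Real.exp (-(4 * c) * Real.sinh (s / 2) ^ 2) * Real.exp (-(2 * c)) := by
            rw [← Real.exp_add, h1]
            ring_nf
          rw [h3, Real.cosh_eq, neg_div]
          ring
      _ = ENNReal.ofReal (∫ q : ℝ, Real.exp (-(4 * c) * q ^ 2) * (4 * Real.exp (-(2 * c)))) := by
          rw [← hsub, ofReal_integral_eq_lintegral_ofReal
            ((integrable_exp_neg_mul_sq (by positivity)).mul_const _)
            (Filter.Eventually.of_forall fun q => by positivity)]
      _ = _ := by
          rw [integral_mul_const, integral_gaussian]
          congr 1
          have : Real.sqrt (Real.pi / (4 * c)) = Real.sqrt (Real.pi / c) / 2 := by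
            rw [show Real.pi / (4 * c) = Real.pi / c / 2 ^ 2 by ring,
              Real.sqrt_div' _ (by positivity),
              Real.sqrt_sq (by positivity)]
          rw [this]
          ring
  rw [← two_mul, ENNReal.ofReal_mul (by norm_num), ENNReal.ofReal_ofNat] at h2
  exact (ENNReal.mul_right_inj (by norm_num) (by norm_num)).1 h2

/-- The case `ν = ±1/2` of the integral representation of the Bessel function, where it is
elementary. -/
theorem lintegral_exp_half_mul_exp {a b : ℝ} (ha : 0 < a) (hb : 0 < b) :
    ∫⁻ s : ℝ, ENNReal.ofReal (Real.exp (s / 2) * Real.exp (-(a * Real.exp s + b * Real.exp (-s)))) =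
      ENNReal.ofReal (Real.sqrt (Real.pi / a) * Real.exp (-(2 * Real.sqrt (a * b)))) := by
  -- the shift by `m` makes the two coefficients equal
  set m := Real.log (Real.sqrt (b / a)) with hm
  have hem : Real.exp m = Real.sqrt (b / a) := Real.exp_log (by positivity)
  have hc : 0 < Real.sqrt (a * b) := by positivity
  rw [← lintegral_add_right_eq_self _ m]
  have h1 : a * Real.sqrt (b / a) = Real.sqrt (a * b) := by
    rw [show a * b = a ^ 2 * (b / a) by field_simp, Real.sqrt_mul (by positivity),
      Real.sqrt_sq ha.le]
  have h2 : b * (Real.sqrt (b / a))⁻¹ = Real.sqrt (a * b) := by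
    rw [← Real.sqrt_inv, show a * b = b ^ 2 * (b / a)⁻¹ by field_simp,
      Real.sqrt_mul (by positivity), Real.sqrt_sq hb.le]
  have h3 : ∀ s, Real.exp ((s + m) / 2) *
      Real.exp (-(a * Real.exp (s + m) + b * Real.exp (-(s + m)))) =
      Real.exp (m / 2) *
        (Real.exp (s / 2) * Real.exp (-(2 * Real.sqrt (a * b) * Real.cosh s))) := fun s => by
    have e1 : a * Real.exp (s + m) + b * Real.exp (-(s + m)) =
        2 * Real.sqrt (a * b) * Real.cosh s := by
      rw [neg_add, Real.exp_add, Real.exp_add, Real.exp_neg m, hem, Real.cosh_eq]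
      linear_combination Real.exp s * h1 + Real.exp (-s) * h2
    rw [e1, add_div, Real.exp_add]
    ring
  simp_rw [h3, ENNReal.ofReal_mul (Real.exp_pos (m / 2)).le]
  rw [lintegral_const_mul _ (by fun_prop)]
  rw [lintegral_exp_half_mul_exp_cosh hc, ← ENNReal.ofReal_mul (Real.exp_pos _).le]
  congr 1
  have h4 : Real.exp (m / 2) * Real.sqrt (Real.pi / Real.sqrt (a * b)) =
      Real.sqrt (Real.pi / a) := by
    have : Real.exp (m / 2) = Real.sqrt (Real.sqrt (b / a)) := by
      rw [← hem, Real.exp_half]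
    rw [this, ← Real.sqrt_mul (by positivity)]
    congr 1
    rw [← h1]
    field_simp
  rw [← mul_assoc, h4]

theorem one_add_sq_div_two_le_cosh (s : ℝ) : 1 + s ^ 2 / 2 ≤ Real.cosh s := by
  have h1 := Real.cosh_two_mul (s / 2)
  rw [mul_div_cancel₀ s two_ne_zero, Real.cosh_sq] at h1
  have h2 : |s / 2| ≤ |Real.sinh (s / 2)| := by
    rw [Real.abs_sinh]
    exact Real.self_le_sinh_iff.2 (abs_nonneg _)
  have h3 := sq_le_sq.2 h2
  linarith [div_pow s 2 2]

theorem integrable_exp_cosh_mul_cosh {z : ℝ} (hz : 0 < z) (ν : ℝ) :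
    Integrable fun s : ℝ => Real.exp (-z * Real.cosh s) * Real.cosh (ν * s) := by
  refine ((integrable_exp_neg_mul_sq (b := z / 4) (by positivity)).const_mul
    (Real.exp (ν ^ 2 / z))).mono' (by fun_prop) (Filter.Eventually.of_forall fun s => ?_)
  rw [Real.norm_eq_abs, abs_of_pos (by positivity)]
  have h1 : ∀ e : ℝ, e ^ 2 = ν ^ 2 → -z * Real.cosh s + e * s ≤ ν ^ 2 / z + -(z / 4) * s ^ 2 := by
    intro e he
    have h2 : z * (1 + s ^ 2 / 2) ≤ z * Real.cosh s := by
      gcongr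
      exact one_add_sq_div_two_le_cosh s
    have h3 : e * s ≤ ν ^ 2 / z + z / 4 * s ^ 2 := by
      rw [← he]
      have : 0 ≤ (e / z - s / 2) ^ 2 * z := by positivity
      have h4 : (e / z - s / 2) ^ 2 * z = e ^ 2 / z + z / 4 * s ^ 2 - e * s := by
        field_simp
        ring
      linarith
    linarith
  rw [← Real.exp_add, Real.cosh_eq (ν * s), ← neg_mul]
  have e1 := Real.exp_le_exp.2 (h1 ν rfl)
  have e2 := Real.exp_le_exp.2 (h1 (-ν) (by ring))
  rw [Real.exp_add] at e1 e2
  linarith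

/-- By symmetry, the Bessel function is also half of the integral over `ℝ` with `exp (-ν s)` in
place of `cosh (ν s)`. -/
theorem lintegral_exp_cosh {z : ℝ} (hz : 0 < z) (ν : ℝ) :
    ∫⁻ s : ℝ, ENNReal.ofReal (Real.exp (-z * Real.cosh s) * Real.exp (-(ν * s))) =
      ENNReal.ofReal (2 * besselK ν z) := by
  set I := ∫⁻ s : ℝ, ENNReal.ofReal (Real.exp (-z * Real.cosh s) * Real.exp (-(ν * s))) with hI
  have hneg : I = ∫⁻ s : ℝ, ENNReal.ofReal (Real.exp (-z * Real.cosh s) * Real.exp (ν * s)) := by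
    rw [hI, ← lintegral_neg_eq_self]
    simp
  have hK : 2 * besselK ν z = ∫ s : ℝ, Real.exp (-z * Real.cosh s) * Real.cosh (ν * s) := by
    rw [besselK,
      ← integral_comp_abs (f := fun s => Real.exp (-z * Real.cosh s) * Real.cosh (ν * s))]
    refine integral_congr_ae (Filter.Eventually.of_forall fun s => ?_)
    dsimp only
    rw [Real.cosh_abs]
    congr 1
    rcases abs_cases s with ⟨h, _⟩ | ⟨h, _⟩ <;> rw [h]
    rw [mul_neg, Real.cosh_neg]
  have h2 : I + I = 2 * ENNReal.ofReal (2 * besselK ν z) := by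
    nth_rewrite 2 [hneg]
    rw [hK, ofReal_integral_eq_lintegral_ofReal (integrable_exp_cosh_mul_cosh hz ν)
      (Filter.Eventually.of_forall fun s => by positivity), hI, ← lintegral_add_left (by fun_prop),
      ← lintegral_const_mul _ (by fun_prop)]
    refine lintegral_congr fun s => ?_
    rw [← ENNReal.ofReal_add (by positivity) (by positivity), ← ENNReal.ofReal_ofNat,
      ← ENNReal.ofReal_mul (by norm_num), Real.cosh_eq (ν * s)]
    congr 1
    ring
  rw [← two_mul] at h2
  exact (ENNReal.mul_right_inj (by norm_num) (by norm_num)).1 h2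

theorem integrableOn_rpow_mul_exp {a c : ℝ} (ha : 0 < a) (hc : 0 < c) :
    IntegrableOn (fun x : ℝ => x ^ (a - 1) * Real.exp (-(c * x))) (Set.Ioi 0) := by
  have := integrableOn_rpow_mul_exp_neg_mul_rpow (p := 1) (s := a - 1) (b := c) (by linarith)
    one_pos hc
  simpa using this

/-- Integrating the Gamma integral for `Γ d` against the Bessel integrand leads to the elementary
Bessel function of order `1/2`. -/
theorem gamma_mul_exp_cosh {d z : ℝ} (hd : 0 < d) (hz : 0 < z) (s : ℝ) :
    ENNReal.ofReal (Real.Gamma d) *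
        ENNReal.ofReal (Real.exp (-z * Real.cosh s) * Real.exp (-((d - 1 / 2) * s))) =
      ∫⁻ ρ in Set.Ioi (0 : ℝ), ENNReal.ofReal ((z / 2) ^ d * ρ ^ (d - 1)) *
        ENNReal.ofReal (Real.exp (s / 2) *
          Real.exp (-(z / 2 * (1 + ρ) * Real.exp s + z / 2 * Real.exp (-s)))) := by
  set κ := z / 2 * Real.exp s with hκ
  have hκ0 : 0 < κ := by positivity
  have hint := integrableOn_rpow_mul_exp hd hκ0
  have h1 := ofReal_integral_eq_lintegral_ofReal
    (hint.const_mul ((z / 2) ^ d * Real.exp (s / 2) * Real.exp (-z * Real.cosh s)))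
    ((ae_restrict_iff' measurableSet_Ioi).2 (Filter.Eventually.of_forall fun ρ hρ => by
      have : (0 : ℝ) < ρ := hρ
      positivity))
  rw [integral_const_mul, Real.integral_rpow_mul_exp_neg_mul_Ioi hd hκ0] at h1
  rw [← ENNReal.ofReal_mul (Real.Gamma_pos_of_pos hd).le]
  have h2 : (1 / κ) ^ d = (z / 2) ^ (-d) * Real.exp (-(d * s)) := by
    rw [one_div, Real.inv_rpow hκ0.le, ← Real.rpow_neg hκ0.le, hκ,
      Real.mul_rpow (by positivity) (Real.exp_pos _).le, ← Real.exp_mul]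
    ring_nf
  have h3 : (z / 2) ^ d * (z / 2) ^ (-d) = 1 := by
    rw [← Real.rpow_add (by positivity), add_neg_cancel, Real.rpow_zero]
  have h4 : Real.exp (-((d - 1 / 2) * s)) = Real.exp (s / 2) * Real.exp (-(d * s)) := by
    rw [← Real.exp_add]
    ring_nf
  have h5 : Real.Gamma d * (Real.exp (-z * Real.cosh s) * Real.exp (-((d - 1 / 2) * s))) =
      (z / 2) ^ d * Real.exp (s / 2) * Real.exp (-z * Real.cosh s) *
        ((1 / κ) ^ d * Real.Gamma d) := by
    rw [h2, h4]
    linear_combination (-Real.Gamma d * Real.exp (-z * Real.cosh s) * Real.exp (s / 2) *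
      Real.exp (-(d * s))) * h3
  rw [h5, h1]
  refine setLIntegral_congr_fun measurableSet_Ioi fun ρ hρ => ?_
  have hρ' : (0 : ℝ) < ρ := hρ
  rw [← ENNReal.ofReal_mul (by positivity)]
  congr 1
  have h6 : Real.exp (-(z / 2 * (1 + ρ) * Real.exp s + z / 2 * Real.exp (-s))) =
      Real.exp (-z * Real.cosh s) * Real.exp (-(κ * ρ)) := by
    rw [← Real.exp_add, Real.cosh_eq, hκ]
    ring_nf
  rw [h6]
  ring

theorem gamma_mul_besselK {d z : ℝ} (hd : 0 < d) (hz : 0 < z) :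
    ENNReal.ofReal (Real.Gamma d * (2 * besselK (d - 1 / 2) z)) =
      ∫⁻ ρ in Set.Ioi (0 : ℝ), ENNReal.ofReal ((z / 2) ^ d * ρ ^ (d - 1) *
        (Real.sqrt (2 * Real.pi / (z * (1 + ρ))) * Real.exp (-(z * Real.sqrt (1 + ρ))))) := by
  rw [ENNReal.ofReal_mul (Real.Gamma_pos_of_pos hd).le, ← lintegral_exp_cosh hz,
    ← lintegral_const_mul _ (by fun_prop)]
  simp_rw [gamma_mul_exp_cosh hd hz]
  rw [lintegral_lintegral_swap (by fun_prop)]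
  refine setLIntegral_congr_fun measurableSet_Ioi fun ρ hρ => ?_
  have hρ' : (0 : ℝ) < ρ := hρ
  rw [lintegral_const_mul _ (by fun_prop), lintegral_exp_half_mul_exp (by positivity)
    (by positivity), ← ENNReal.ofReal_mul (by positivity)]
  have h1 : Real.sqrt (z / 2 * (1 + ρ) * (z / 2)) = z / 2 * Real.sqrt (1 + ρ) := by
    rw [show z / 2 * (1 + ρ) * (z / 2) = (z / 2) ^ 2 * (1 + ρ) by ring,
      Real.sqrt_mul (by positivity), Real.sqrt_sq (by positivity)]
  have h2 : Real.pi / (z / 2 * (1 + ρ)) = 2 * Real.pi / (z * (1 + ρ)) := by field_simp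
  rw [h1, h2, show 2 * (z / 2 * Real.sqrt (1 + ρ)) = z * Real.sqrt (1 + ρ) by ring]

theorem besselK_neg (ν z : ℝ) : besselK (-ν) z = besselK ν z := by
  simp [besselK]

theorem lintegral_autocovariance {d lam r : ℝ} (hd : 0 < d) (hlam : 0 < lam) (hr : 0 < r) :
    ∫⁻ y in Set.Ioi (0 : ℝ), ENNReal.ofReal
        (y ^ (d - 1) * (y + r) ^ (d - 1) * Real.exp (-lam * (2 * y + r))) =
      ENNReal.ofReal (Real.Gamma d / (Real.sqrt Real.pi * (2 * lam) ^ (d - 1 / 2)) *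
        (r ^ (d - 1 / 2) * besselK (1 / 2 - d) (lam * r))) := by
  have hz : 0 < lam * r := by positivity
  -- the substitution `ρ = 4 y (y + r) / r ^ 2`, for which `1 + ρ = ((2 y + r) / r) ^ 2`
  have himage : (fun y : ℝ => 4 / r ^ 2 * (y * (y + r))) '' Set.Ioi 0 = Set.Ioi 0 := by
    ext ρ
    constructor
    · rintro ⟨y, hy, rfl⟩
      have : (0 : ℝ) < y := hy
      exact Set.mem_Ioi.2 (by positivity)
    · intro hρ
      have hρ' : (0 : ℝ) < ρ := hρ
      refine ⟨r / 2 * (Real.sqrt (1 + ρ) - 1), ?_, ?_⟩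
      · have : 1 < Real.sqrt (1 + ρ) := by
          rw [Real.lt_sqrt (by norm_num)]
          linarith
        exact Set.mem_Ioi.2 (by nlinarith)
      · have := Real.sq_sqrt (show 0 ≤ 1 + ρ by positivity)
        field_simp
        linear_combination 4 * this
  have hsub := lintegral_image_eq_lintegral_abs_deriv_mul (s := Set.Ioi (0 : ℝ))
    (f := fun y : ℝ => 4 / r ^ 2 * (y * (y + r)))
    (f' := fun y => 4 / r ^ 2 * (1 * (y + r) + y * 1))
    measurableSet_Ioi
    (fun y _ => (((hasDerivAt_id' y).mul ((hasDerivAt_id' y).add_const r)).const_mul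
      _).hasDerivWithinAt)
    (fun a ha b hb h => by
      have ha' : (0 : ℝ) < a := ha
      have hb' : (0 : ℝ) < b := hb
      have h1 : a * (a + r) = b * (b + r) :=
        mul_left_cancel₀ (show 4 / r ^ 2 ≠ 0 by positivity) h
      have h2 : (a - b) * (a + b + r) = 0 := by linear_combination h1
      rcases mul_eq_zero.1 h2 with h3 | h3
      · linarith
      · linarith)
    (fun ρ => ENNReal.ofReal ((lam * r / 2) ^ d * ρ ^ (d - 1) *
        (Real.sqrt (2 * Real.pi / (lam * r * (1 + ρ))) *
          Real.exp (-(lam * r * Real.sqrt (1 + ρ))))))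
  rw [himage, ← gamma_mul_besselK hd hz] at hsub
  set c := (lam * r / 2) ^ d * (4 / r ^ 2) ^ d * r * Real.sqrt (2 * Real.pi / (lam * r)) with hc
  have hc0 : 0 < c := by positivity
  have hcongr : ∀ y ∈ Set.Ioi (0 : ℝ), ENNReal.ofReal |4 / r ^ 2 * (1 * (y + r) + y * 1)| *
      ENNReal.ofReal ((lam * r / 2) ^ d * (4 / r ^ 2 * (y * (y + r))) ^ (d - 1) *
        (Real.sqrt (2 * Real.pi / (lam * r * (1 + 4 / r ^ 2 * (y * (y + r))))) *
          Real.exp (-(lam * r * Real.sqrt (1 + 4 / r ^ 2 * (y * (y + r))))))) =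
      ENNReal.ofReal c * ENNReal.ofReal
        (y ^ (d - 1) * (y + r) ^ (d - 1) * Real.exp (-lam * (2 * y + r))) := by
    intro y hy
    have hy' : (0 : ℝ) < y := hy
    have h1 : 1 + 4 / r ^ 2 * (y * (y + r)) = ((2 * y + r) / r) ^ 2 := by
      field_simp
      ring
    rw [← ENNReal.ofReal_mul (abs_nonneg _), ← ENNReal.ofReal_mul hc0.le,
      abs_of_pos (by positivity), h1, Real.sqrt_sq (by positivity)]
    congr 1
    have h2 : 2 * Real.pi / (lam * r * ((2 * y + r) / r) ^ 2) =
        2 * Real.pi / (lam * r) / ((2 * y + r) / r) ^ 2 := by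
      field_simp
    have h3 : (4 / r ^ 2) ^ d = (4 / r ^ 2) ^ (d - 1) * (4 / r ^ 2) := by
      rw [← Real.rpow_add_one (by positivity), sub_add_cancel]
    have h4 : lam * r * ((2 * y + r) / r) = lam * (2 * y + r) := by
      field_simp
    rw [h2, Real.sqrt_div' _ (by positivity), Real.sqrt_sq (by positivity), h4, hc, h3,
      Real.mul_rpow (by positivity) (by positivity), Real.mul_rpow hy'.le (by positivity)]
    field_simp
    ring
  rw [setLIntegral_congr_fun measurableSet_Ioi hcongr,
    lintegral_const_mul _ (by fun_prop)] at hsub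
  have hval : Real.Gamma d * (2 * besselK (d - 1 / 2) (lam * r)) =
      c * (Real.Gamma d / (Real.sqrt Real.pi * (2 * lam) ^ (d - 1 / 2)) *
        (r ^ (d - 1 / 2) * besselK (1 / 2 - d) (lam * r))) := by
    rw [← besselK_neg, neg_sub]
    have h1 : (lam * r / 2) ^ d * (4 / r ^ 2) ^ d = (2 * lam) ^ d * (r ^ d)⁻¹ := by
      rw [← Real.mul_rpow (by positivity) (by positivity), ← Real.inv_rpow hr.le,
        ← Real.mul_rpow (by positivity) (by positivity)]
      congr 1
      field_simp
      norm_num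
    have h2 : Real.sqrt (2 * Real.pi / (lam * r)) =
        2 * Real.sqrt Real.pi / (Real.sqrt (2 * lam) * Real.sqrt r) := by
      rw [show 2 * Real.pi / (lam * r) = 2 ^ 2 * Real.pi / (2 * lam * r) by field_simp,
        Real.sqrt_div' _ (by positivity), Real.sqrt_mul (by positivity),
        Real.sqrt_mul (by positivity), Real.sqrt_sq (by norm_num)]
    have h3 : r ^ (d - 1 / 2) = r ^ d / Real.sqrt r := by
      rw [Real.rpow_sub hr, Real.sqrt_eq_rpow]
    have h4 : (2 * lam) ^ (d - 1 / 2) = (2 * lam) ^ d / Real.sqrt (2 * lam) := by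
      rw [Real.rpow_sub (by positivity), Real.sqrt_eq_rpow]
    have h5 := Real.sq_sqrt hr.le
    rw [hc, h1, h2, h3, h4]
    field_simp
    rw [h5]
    ring
  rw [hval, ENNReal.ofReal_mul hc0.le] at hsub
  exact ((ENNReal.mul_right_inj (by simpa using hc0) ENNReal.ofReal_ne_top).1 hsub).symm

/-! ### The tempered kernel and its autocovariance -/

/-- The tempered fractional kernel `y ↦ y₊ ^ (d - 1) exp (-λ y₊)`. -/
def temperedKernel (d lam y : ℝ) : ℝ := posPow y (d - 1) * Real.exp (-lam * max y 0)

/-- The autocovariance `r ↦ ∫ g (r - y) g (-y) dy` of the tempered fractional kernel `g`, in closed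
form. At `r = 0` the value is irrelevant. -/
def autocovariance (d lam r : ℝ) : ℝ :=
  Real.Gamma d / (Real.sqrt Real.pi * (2 * lam) ^ (d - 1 / 2)) *
    (|r| ^ (d - 1 / 2) * besselK (1 / 2 - d) (lam * |r|))

theorem posPow_nonneg (x a : ℝ) : 0 ≤ posPow x a := by
  unfold posPow
  split_ifs with h
  · exact Real.rpow_nonneg h.le _
  · exact le_rfl

theorem measurable_posPow (a : ℝ) : Measurable fun x => posPow x a :=
  Measurable.ite measurableSet_Ioi (by fun_prop) measurable_const

theorem temperedKernel_nonneg (d lam y : ℝ) : 0 ≤ temperedKernel d lam y :=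
  mul_nonneg (posPow_nonneg _ _) (Real.exp_pos _).le

theorem measurable_temperedKernel (d lam : ℝ) : Measurable (temperedKernel d lam) :=
  (measurable_posPow _).mul (by fun_prop)

theorem besselK_nonneg (ν z : ℝ) : 0 ≤ besselK ν z :=
  setIntegral_nonneg measurableSet_Ioi fun s _ => by positivity

theorem autocovariance_nonneg {d lam : ℝ} (hd : 0 < d) (hlam : 0 < lam) (r : ℝ) :
    0 ≤ autocovariance d lam r := by
  have := Real.Gamma_pos_of_pos hd
  have := besselK_nonneg (1 / 2 - d) (lam * |r|)
  unfold autocovariance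
  positivity

theorem temperedKernel_mul_eq_indicator (d lam : ℝ) {r : ℝ} (hr : 0 < r) :
    (fun y => temperedKernel d lam (y + r) * temperedKernel d lam y) =
      (Set.Ioi (0 : ℝ)).indicator fun y =>
        y ^ (d - 1) * (y + r) ^ (d - 1) * Real.exp (-lam * (2 * y + r)) := by
  ext y
  by_cases hy : 0 < y
  · have h1 : 0 < y + r := by linarith
    rw [Set.indicator_of_mem (Set.mem_Ioi.2 hy)]
    simp only [temperedKernel, posPow, hy, h1, if_true, max_eq_left hy.le, max_eq_left h1.le]
    rw [show -lam * (2 * y + r) = -lam * (y + r) + -lam * y by ring, Real.exp_add]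
    ring
  · rw [Set.indicator_of_notMem (by simpa using hy)]
    simp [temperedKernel, posPow, hy]

theorem integrable_temperedKernel_mul {d lam r : ℝ} (hd : 0 < d) (hlam : 0 < lam) (hr : 0 < r) :
    Integrable (fun y => temperedKernel d lam (y + r) * temperedKernel d lam y) ∧
      ∫ y, temperedKernel d lam (y + r) * temperedKernel d lam y = autocovariance d lam r := by
  have hmeas := measurable_temperedKernel d lam
  have hnn : ∀ y, 0 ≤ temperedKernel d lam (y + r) * temperedKernel d lam y := fun y =>
    mul_nonneg (temperedKernel_nonneg _ _ _) (temperedKernel_nonneg _ _ _)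
  have hl : ∫⁻ y, ENNReal.ofReal (temperedKernel d lam (y + r) * temperedKernel d lam y) =
      ENNReal.ofReal (autocovariance d lam r) := by
    rw [autocovariance, abs_of_pos hr, ← lintegral_autocovariance hd hlam hr,
      ← lintegral_indicator measurableSet_Ioi]
    refine lintegral_congr fun y => ?_
    rw [congrFun (temperedKernel_mul_eq_indicator d lam hr) y]
    by_cases hy : y ∈ Set.Ioi (0 : ℝ) <;> simp [hy]
  have hm : AEStronglyMeasurable
      (fun y => temperedKernel d lam (y + r) * temperedKernel d lam y) := by
    refine Measurable.aestronglyMeasurable ?_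
    fun_prop
  refine ⟨(lintegral_ofReal_ne_top_iff_integrable hm (Filter.Eventually.of_forall hnn)).1
    (hl ▸ ENNReal.ofReal_ne_top), ?_⟩
  rw [integral_eq_lintegral_of_nonneg_ae (Filter.Eventually.of_forall hnn) hm, hl,
    ENNReal.toReal_ofReal (autocovariance_nonneg hd hlam r)]

theorem autocovariance_neg (d lam r : ℝ) : autocovariance d lam (-r) = autocovariance d lam r := by
  simp [autocovariance]

theorem integrable_temperedKernel_sub {d lam : ℝ} (hd : 0 < d) (hlam : 0 < lam) {u v : ℝ}
    (huv : u ≠ v) :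
    Integrable (fun y => temperedKernel d lam (u - y) * temperedKernel d lam (v - y)) ∧
      ∫ y, temperedKernel d lam (u - y) * temperedKernel d lam (v - y) =
        autocovariance d lam (u - v) := by
  wlog h : v < u generalizing u v
  · have h1 := this huv.symm (lt_of_le_of_ne (not_lt.1 h) huv)
    rw [← neg_sub, autocovariance_neg] at h1
    simpa only [mul_comm] using h1
  obtain ⟨h1, h2⟩ := integrable_temperedKernel_mul hd hlam (sub_pos.2 h)
  have h3 : ∀ y, v - y + (u - v) = u - y := fun y => by ring
  refine ⟨?_, ?_⟩
  · simpa only [h3] using h1.comp_sub_left v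
  · have h4 := integral_sub_left_eq_self
      (fun y => temperedKernel d lam (y + (u - v)) * temperedKernel d lam y) volume v
    simp only [h3] at h4
    exact h4.trans h2

theorem exists_rpow_le_exp {q c : ℝ} (hq : 0 ≤ q) (hc : 0 < c) :
    ∃ C : ℝ, 0 < C ∧ ∀ w : ℝ, 0 < w → w ^ q * Real.exp (-(c * w)) ≤ C := by
  have hε : 0 < c / (q + 1) := by positivity
  refine ⟨Real.exp (q * -Real.log (c / (q + 1))), Real.exp_pos _, fun w hw => ?_⟩
  rw [Real.rpow_def_of_pos hw, ← Real.exp_add, Real.exp_le_exp]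
  have h1 := Real.log_le_sub_one_of_pos (mul_pos hε hw)
  rw [Real.log_mul hε.ne' hw.ne'] at h1
  have h2 : q * (c / (q + 1)) ≤ c := by
    rw [mul_div_assoc', div_le_iff₀ (by positivity)]
    nlinarith
  have h3 := mul_le_mul_of_nonneg_left h1 hq
  have h4 := mul_le_mul_of_nonneg_right h2 hw.le
  nlinarith

/-- The autocovariance has at worst a power singularity at `0`, of any order above `1 - 2 d`, and
decays exponentially. -/
theorem exists_autocovariance_le {d lam b : ℝ} (hd : 0 < d) (hlam : 0 < lam) (hb : 0 < b)
    (hbd : 1 - 2 * d < b) :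
    ∃ C : ℝ, 0 < C ∧ ∀ r, r ≠ 0 →
      autocovariance d lam r ≤ C * (|r| ^ (-b) * Real.exp (-(lam / 2 * |r|))) := by
  set m := max 0 (1 - d - b) with hm
  have hm0 : 0 ≤ m := le_max_left _ _
  have hmd : m < d := max_lt hd (by linarith)
  have hq : 0 ≤ d - 1 + b + m := by linarith [le_max_right 0 (1 - d - b)]
  obtain ⟨C₀, hC₀, hC⟩ := exists_rpow_le_exp hq (half_pos hlam)
  have hint := integrableOn_rpow_mul_exp (a := d - m) (c := lam) (by linarith) hlam
  refine ⟨C₀ * ((∫ y in Set.Ioi (0 : ℝ), y ^ (d - m - 1) * Real.exp (-(lam * y))) + 1), ?_, ?_⟩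
  · have : 0 ≤ ∫ y in Set.Ioi (0 : ℝ), y ^ (d - m - 1) * Real.exp (-(lam * y)) :=
      setIntegral_nonneg measurableSet_Ioi fun y hy => by
        have : (0 : ℝ) < y := hy
        positivity
    positivity
  intro r hr
  wlog hr0 : 0 < r generalizing r
  · have := this (-r) (neg_ne_zero.2 hr) (neg_pos.2 (lt_of_le_of_ne (not_lt.1 hr0) hr))
    rwa [autocovariance_neg, abs_neg] at this
  obtain ⟨h1, h2⟩ := integrable_temperedKernel_mul hd hlam hr0
  rw [temperedKernel_mul_eq_indicator d lam hr0, integrable_indicator_iff measurableSet_Ioi] at h1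
  rw [temperedKernel_mul_eq_indicator d lam hr0, integral_indicator measurableSet_Ioi] at h2
  rw [abs_of_pos hr0, ← h2]
  calc _ ≤ ∫ y in Set.Ioi (0 : ℝ), C₀ * (r ^ (-b) * Real.exp (-(lam / 2 * r))) *
        (y ^ (d - m - 1) * Real.exp (-(lam * y))) := by
        refine setIntegral_mono_on h1 (hint.const_mul _) measurableSet_Ioi fun y hy => ?_
        have hy' : (0 : ℝ) < y := hy
        have hw : 0 < y + r := by positivity
        have e1 : (y + r) ^ (d - 1) = (y + r) ^ (d - 1 + b + m) * (y + r) ^ (-b) *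
            (y + r) ^ (-m) := by
          rw [← Real.rpow_add hw, ← Real.rpow_add hw]
          ring_nf
        have e2 : Real.exp (-lam * (2 * y + r)) = Real.exp (-(lam / 2 * (y + r))) *
            Real.exp (-(lam / 2 * (y + r))) * Real.exp (-(lam * y)) := by
          rw [← Real.exp_add, ← Real.exp_add]
          ring_nf
        have e3 : (y + r) ^ (-b) ≤ r ^ (-b) :=
          Real.rpow_le_rpow_of_nonpos hr0 (by linarith) (by linarith)
        have e4 : (y + r) ^ (-m) ≤ y ^ (-m) :=
          Real.rpow_le_rpow_of_nonpos hy' (by linarith) (by linarith)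
        have e5 : Real.exp (-(lam / 2 * (y + r))) ≤ Real.exp (-(lam / 2 * r)) := by
          rw [Real.exp_le_exp]
          nlinarith
        have e6 : y ^ (d - m - 1) = y ^ (d - 1) * y ^ (-m) := by
          rw [← Real.rpow_add hy']
          ring_nf
        calc _ = ((y + r) ^ (d - 1 + b + m) * Real.exp (-(lam / 2 * (y + r)))) *
              ((y + r) ^ (-b) * Real.exp (-(lam / 2 * (y + r)))) *
              (y ^ (d - 1) * (y + r) ^ (-m) * Real.exp (-(lam * y))) := by
              rw [e1, e2]
              ring
          _ ≤ C₀ * (r ^ (-b) * Real.exp (-(lam / 2 * r))) *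
              (y ^ (d - 1) * y ^ (-m) * Real.exp (-(lam * y))) := by
              gcongr
              exact hC _ hw
          _ = _ := by rw [e6]
    _ = C₀ * (r ^ (-b) * Real.exp (-(lam / 2 * r))) *
        ∫ y in Set.Ioi (0 : ℝ), y ^ (d - m - 1) * Real.exp (-(lam * y)) := integral_const_mul _ _
    _ ≤ _ := by
        have : 0 ≤ C₀ * (r ^ (-b) * Real.exp (-(lam / 2 * r))) := by positivity
        nlinarith

/-! ### Integrability of the fractional filter -/

theorem posPow_of_nonpos {x : ℝ} (hx : x ≤ 0) (a : ℝ) : posPow x a = 0 := if_neg hx.not_gt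

theorem posPow_of_pos {x : ℝ} (hx : 0 < x) (a : ℝ) : posPow x a = x ^ a := if_pos hx

theorem measurable_fracFilter (β t : ℝ) : Measurable (fracFilter β t) :=
  ((measurable_posPow β).comp (measurable_const.sub measurable_id)).sub
    ((measurable_posPow β).comp measurable_neg)

theorem fracFilter_sub (β t s u : ℝ) :
    fracFilter β t u - fracFilter β s u = fracFilter β (t - s) (u - s) := by
  simp [fracFilter]

theorem fracFilter_zero (β u : ℝ) : fracFilter β 0 u = 0 := by
  simp [fracFilter]

theorem integrable_indicator_posPow {s : ℝ} (hs : -1 < s) {c : ℝ} (hc : 0 ≤ c) :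
    Integrable ((Set.Icc (-c) c).indicator fun x => posPow x s) := by
  have h1 : IntegrableOn (fun x : ℝ => x ^ s) (Set.Ioc (-c) c) :=
    (intervalIntegrable_iff_integrableOn_Ioc_of_le (by linarith)).1
      (intervalIntegral.intervalIntegrable_rpow' hs)
  have h2 : IntegrableOn (fun x => posPow x s) (Set.Ioc (-c) c) := by
    have h3 : (fun x => posPow x s) = (Set.Ioi (0 : ℝ)).indicator fun x => x ^ s := by
      ext x
      simp [posPow, Set.indicator_apply]
    rw [h3]
    exact h1.indicator measurableSet_Ioi
  exact (integrable_indicator_iff measurableSet_Icc).2 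
    ((integrableOn_Icc_iff_integrableOn_Ioc (by simp)).2 h2)

theorem abs_rpow_add_sub_rpow_le {β w t : ℝ} (hβ : β ≤ 1) (hw : 0 < w) (ht : 0 ≤ t) :
    |(t + w) ^ β - w ^ β| ≤ |β| * w ^ (β - 1) * t := by
  have h := Convex.norm_image_sub_le_of_norm_hasDerivWithin_le (s := Set.Ici w)
    (f := fun x : ℝ => x ^ β) (f' := fun x => β * x ^ (β - 1)) (C := |β| * w ^ (β - 1))
    (x := w) (y := t + w)
    (fun x hx => (Real.hasDerivAt_rpow_const (Or.inl (hw.trans_le hx).ne')).hasDerivWithinAt)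
    (fun x hx => by
      have hx0 : 0 < x := hw.trans_le hx
      rw [norm_mul, Real.norm_eq_abs, Real.norm_eq_abs, abs_of_pos (Real.rpow_pos_of_pos hx0 _)]
      gcongr ?_ * ?_
      exact Real.rpow_le_rpow_of_nonpos hw hx (by linarith))
    (convex_Ici w) (Set.mem_Ici.2 le_rfl) (Set.mem_Ici.2 (by linarith))
  simpa [abs_of_nonneg ht] using h

/-- The filter has the local singularities of `u ↦ u₊ ^ β` and decays like `|u| ^ (β - 1)`
at `-∞`. -/
theorem integrable_abs_fracFilter_rpow_of_pos {β p t : ℝ} (hp : 0 < p) (hβ : β ≤ 1)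
    (hloc : -1 < β * p) (hinf : (β - 1) * p < -1) (ht : 0 < t) :
    Integrable fun u => |fracFilter β t u| ^ p := by
  set G := (Set.Icc (-(2 * t)) (2 * t)).indicator fun x => posPow x (β * p) with hG
  have hGi : Integrable G := integrable_indicator_posPow hloc (by positivity)
  have hG0 : ∀ x, 0 ≤ G x := fun x => Set.indicator_nonneg (fun x _ => posPow_nonneg _ _) x
  set F := (Set.Ioi t).indicator fun w : ℝ => (|β| * t) ^ p * w ^ ((β - 1) * p) with hF
  have hFi : Integrable F := (integrable_indicator_iff measurableSet_Ioi).2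
    ((integrableOn_Ioi_rpow_of_lt hinf ht).const_mul _)
  have hF0 : ∀ x, 0 ≤ F x := fun x => Set.indicator_nonneg (fun w hw => by
    have : 0 < w := ht.trans hw
    positivity) x
  refine (((hGi.comp_sub_left t).add (hGi.comp_sub_left 0)).add (hFi.comp_sub_left 0)).mono'
    ((measurable_fracFilter β t).abs.pow_const p).aestronglyMeasurable
    (Filter.Eventually.of_forall fun u => ?_)
  rw [Real.norm_eq_abs, abs_of_nonneg (Real.rpow_nonneg (abs_nonneg _) _)]
  simp only [Pi.add_apply, zero_sub]
  have hrp : ∀ x, posPow x β ^ p = posPow x (β * p) := fun x => by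
    unfold posPow
    split_ifs with h
    · rw [Real.rpow_mul h.le]
    · exact Real.zero_rpow hp.ne'
  rcases le_or_gt t u with hu | hu
  · have : fracFilter β t u = 0 := by
      rw [fracFilter, posPow_of_nonpos (by linarith), posPow_of_nonpos (by linarith), sub_zero]
    rw [this, abs_zero, Real.zero_rpow hp.ne']
    linarith [hG0 (t - u), hG0 (-u), hF0 (-u)]
  rcases le_or_gt (-t) u with hu' | hu'
  · have e1 : G (t - u) = posPow (t - u) (β * p) :=
      Set.indicator_of_mem (Set.mem_Icc.2 ⟨by linarith, by linarith⟩) _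
    have e2 : G (-u) = posPow (-u) (β * p) :=
      Set.indicator_of_mem (Set.mem_Icc.2 ⟨by linarith, by linarith⟩) _
    have h1 : |fracFilter β t u| ^ p ≤ posPow (t - u) β ^ p + posPow (-u) β ^ p := by
      have ha := posPow_nonneg (t - u) β
      have hb := posPow_nonneg (-u) β
      have ha' := Real.rpow_nonneg ha p
      have hb' := Real.rpow_nonneg hb p
      rcases le_total (posPow (t - u) β) (posPow (-u) β) with h | h
      · have : |fracFilter β t u| ≤ posPow (-u) β := by
          rw [fracFilter, abs_le]
          constructor <;> linarith
        linarith [Real.rpow_le_rpow (abs_nonneg _) this hp.le]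
      · have : |fracFilter β t u| ≤ posPow (t - u) β := by
          rw [fracFilter, abs_le]
          constructor <;> linarith
        linarith [Real.rpow_le_rpow (abs_nonneg _) this hp.le]
    rw [hrp, hrp] at h1
    rw [e1, e2]
    linarith [hF0 (-u)]
  · have e1 : F (-u) = (|β| * t) ^ p * (-u) ^ ((β - 1) * p) :=
      Set.indicator_of_mem (Set.mem_Ioi.2 (by linarith)) _
    have hw : 0 < -u := by linarith
    have h1 : |fracFilter β t u| ≤ |β| * t * (-u) ^ (β - 1) := by
      rw [fracFilter, posPow_of_pos (by linarith), posPow_of_pos hw, sub_eq_add_neg t u]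
      refine (abs_rpow_add_sub_rpow_le hβ hw ht.le).trans (le_of_eq (by ring))
    have h2 := Real.rpow_le_rpow (abs_nonneg _) h1 hp.le
    rw [Real.mul_rpow (by positivity) (by positivity), ← Real.rpow_mul hw.le] at h2
    rw [e1]
    linarith [hG0 (t - u), hG0 (-u)]

theorem integrable_abs_fracFilter_rpow {β p : ℝ} (hp : 0 < p) (hβ : β ≤ 1)
    (hloc : -1 < β * p) (hinf : (β - 1) * p < -1) (t : ℝ) :
    Integrable fun u => |fracFilter β t u| ^ p := by
  rcases lt_trichotomy t 0 with ht | rfl | ht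
  · have h1 : ∀ u, |fracFilter β t u| = |fracFilter β (-t) (u - t)| := fun u => by
      have h2 := fracFilter_sub β 0 t u
      rw [fracFilter_zero, zero_sub, zero_sub] at h2
      rw [← h2, abs_neg]
    simp_rw [h1]
    exact (integrable_abs_fracFilter_rpow_of_pos hp hβ hloc hinf (neg_pos.2 ht)).comp_sub_right t
  · simp [fracFilter_zero, Real.zero_rpow hp.ne']
  · exact integrable_abs_fracFilter_rpow_of_pos hp hβ hloc hinf ht

/-! ### A trilinear form of Young's inequality -/

/-- The pointwise inequality behind Young's convolution inequality, by the weighted inequality of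
arithmetic and geometric means with weights `2 a - 1`, `1 - a` and `1 - a`. -/
theorem mul_mul_le_young {a x y z : ℝ} (ha : 1 / 2 ≤ a) (ha1 : a < 1) (hx : 0 ≤ x) (hy : 0 ≤ y)
    (hz : 0 ≤ z) :
    x * y * z ≤ x ^ (1 / a) * y ^ (1 / a) + x ^ (1 / a) * z ^ (1 / (2 - 2 * a)) +
      y ^ (1 / a) * z ^ (1 / (2 - 2 * a)) := by
  have hX := Real.rpow_nonneg hx (1 / a)
  have hY := Real.rpow_nonneg hy (1 / a)
  have hZ := Real.rpow_nonneg hz (1 / (2 - 2 * a))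
  have h := Real.geom_mean_le_arith_mean3_weighted (w₁ := 2 * a - 1) (w₂ := 1 - a) (w₃ := 1 - a)
    (by linarith) (by linarith) (by linarith) (mul_nonneg hX hY) (mul_nonneg hX hZ)
    (mul_nonneg hY hZ) (by ring)
  have hroot : ∀ {w e : ℝ}, 0 ≤ w → 0 < e → (w ^ (1 / e)) ^ e = w := fun {w e} hw he => by
    rw [← Real.rpow_mul hw, one_div_mul_cancel he.ne', Real.rpow_one]
  have e1 : ∀ {w : ℝ}, 0 ≤ w → w ^ (2 * a - 1) * w ^ (1 - a) = w ^ a := fun {w} hw => by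
    rw [← Real.rpow_add_of_nonneg hw (by linarith) (by linarith)]
    ring_nf
  have e2 : ∀ {w : ℝ}, 0 ≤ w → w ^ (1 - a) * w ^ (1 - a) = w ^ (2 - 2 * a) := fun {w} hw => by
    rw [← Real.rpow_add_of_nonneg hw (by linarith) (by linarith)]
    ring_nf
  have hl : (x ^ (1 / a) * y ^ (1 / a)) ^ (2 * a - 1) *
      (x ^ (1 / a) * z ^ (1 / (2 - 2 * a))) ^ (1 - a) *
      (y ^ (1 / a) * z ^ (1 / (2 - 2 * a))) ^ (1 - a) = x * y * z := by
    rw [Real.mul_rpow hX hY, Real.mul_rpow hX hZ, Real.mul_rpow hY hZ]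
    calc _ = ((x ^ (1 / a)) ^ (2 * a - 1) * (x ^ (1 / a)) ^ (1 - a)) *
          ((y ^ (1 / a)) ^ (2 * a - 1) * (y ^ (1 / a)) ^ (1 - a)) *
          ((z ^ (1 / (2 - 2 * a))) ^ (1 - a) * (z ^ (1 / (2 - 2 * a))) ^ (1 - a)) := by ring
      _ = _ := by
        rw [e1 hX, e1 hY, e2 hZ, hroot hx (by linarith), hroot hy (by linarith),
          hroot hz (by linarith)]
  rw [hl] at h
  have h1 : (2 * a - 1) * (x ^ (1 / a) * y ^ (1 / a)) ≤ 1 * (x ^ (1 / a) * y ^ (1 / a)) := by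
    gcongr
    linarith
  have h2 : (1 - a) * (x ^ (1 / a) * z ^ (1 / (2 - 2 * a))) ≤
      1 * (x ^ (1 / a) * z ^ (1 / (2 - 2 * a))) := by
    gcongr
    linarith
  have h3 : (1 - a) * (y ^ (1 / a) * z ^ (1 / (2 - 2 * a))) ≤
      1 * (y ^ (1 / a) * z ^ (1 / (2 - 2 * a))) := by
    gcongr
    linarith
  linarith

theorem integrable_mul_mul_comp_sub {f φ : ℝ → ℝ} {a : ℝ} (ha : 1 / 2 ≤ a) (ha1 : a < 1)
    (hf : Measurable f) (hφ : Measurable φ)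
    (hfi : Integrable fun u => |f u| ^ (1 / a))
    (hφi : Integrable fun r => |φ r| ^ (1 / (2 - 2 * a))) :
    Integrable fun q : ℝ × ℝ => f q.1 * f q.2 * φ (q.1 - q.2) := by
  have h1 : Integrable fun q : ℝ × ℝ => |f q.1| ^ (1 / a) * |f q.2| ^ (1 / a) := hfi.mul_prod hfi
  have h3 : Integrable fun q : ℝ × ℝ => |f q.2| ^ (1 / a) * |φ (q.1 - q.2)| ^ (1 / (2 - 2 * a)) :=
    (measurePreserving_prod_sub_swap (volume : Measure ℝ)
      (volume : Measure ℝ)).integrable_comp_of_integrable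
      (hfi.mul_prod hφi)
  have h2 : Integrable fun q : ℝ × ℝ =>
      |f q.1| ^ (1 / a) * |φ (q.1 - q.2)| ^ (1 / (2 - 2 * a)) := by
    have h4 : Integrable fun q : ℝ × ℝ =>
        |f q.1| ^ (1 / a) * |φ (-(q.2 - q.1))| ^ (1 / (2 - 2 * a)) :=
      (measurePreserving_prod_sub (volume : Measure ℝ)
      (volume : Measure ℝ)).integrable_comp_of_integrable
        (hfi.mul_prod hφi.comp_neg)
    simpa using h4
  refine ((h1.add h2).add h3).mono' (by fun_prop) (Filter.Eventually.of_forall fun q => ?_)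
  rw [norm_mul, norm_mul]
  exact mul_mul_le_young ha ha1 (abs_nonneg _) (abs_nonneg _) (abs_nonneg _)

/-! ### The quadratic form of the filter -/

theorem measurable_besselK (ν : ℝ) : Measurable (besselK ν) := by
  unfold besselK
  refine (StronglyMeasurable.integral_prod_right (f := fun x r : ℝ =>
    Real.exp (-x * Real.cosh r) * Real.cosh (ν * r)) ?_).measurable
  exact Continuous.stronglyMeasurable (by fun_prop)

theorem measurable_autocovariance (d lam : ℝ) : Measurable (autocovariance d lam) := by
  unfold autocovariance
  have := measurable_besselK (1 / 2 - d)
  fun_prop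

theorem integrable_abs_rpow_mul_exp {s c : ℝ} (hs : s < 1) (hc : 0 < c) :
    Integrable fun r : ℝ => |r| ^ (-s) * Real.exp (-(c * |r|)) := by
  have h1 : Integrable ((Set.Ioi (0 : ℝ)).indicator fun x : ℝ =>
      x ^ (1 - s - 1) * Real.exp (-(c * x))) :=
    (integrable_indicator_iff measurableSet_Ioi).2 (integrableOn_rpow_mul_exp (by linarith) hc)
  refine (h1.add h1.comp_neg).congr ?_
  filter_upwards [compl_mem_ae_iff.2 (measure_singleton (0 : ℝ))] with r hr
  rcases lt_or_gt_of_ne hr with h | h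
  · simp [h, h.le, abs_of_neg]
  · simp [h, h.le, abs_of_pos]

/-- The choice of exponents: `b` bounds the singularity of the autocovariance, and the filter is to
be in `L^{1/a}` and the `k`-th power of the autocovariance in `L^{1/(2 - 2 a)}`. -/
theorem exists_exponents {k : ℕ} (hk : 1 ≤ k) {d β : ℝ} (hd : 1 / 2 - 1 / (2 * (k : ℝ)) < d)
    (hβ₁ : -1 < β) (hβ₂ : -(1 + (k : ℝ) * (d - 1 / 2)) < β) (hβ₃ : β < 1 / 2) :
    0 < d ∧ ∃ b a : ℝ, 0 < b ∧ 1 - 2 * d < b ∧ 1 / 2 ≤ a ∧ a < 1 ∧ -β < a ∧ a < 1 - β ∧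
      k * b < 2 - 2 * a := by
  have hk1 : (1 : ℝ) ≤ k := by exact_mod_cast hk
  have hk0 : (0 : ℝ) < k := by linarith
  have hkd : (k : ℝ) * (1 - 2 * d) < 1 := by
    have h1 : 1 - 2 * d < 1 / k := by
      have : 1 / (2 * (k : ℝ)) = 1 / k / 2 := by field_simp
      linarith
    calc (k : ℝ) * (1 - 2 * d) < k * (1 / k) := by gcongr
      _ = 1 := by field_simp
  have hd0 : 0 < d := by
    by_contra h
    nlinarith
  refine ⟨hd0, ?_⟩
  -- `c` stands for `k b`
  obtain ⟨c, hc1, hc2⟩ := exists_between (show max 0 ((k : ℝ) * (1 - 2 * d)) < min 1 (2 + 2 * β) by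
    rw [max_lt_iff, lt_min_iff, lt_min_iff]
    refine ⟨⟨by norm_num, by linarith⟩, hkd, by linarith⟩)
  rw [max_lt_iff] at hc1
  rw [lt_min_iff] at hc2
  obtain ⟨a, ha1, ha2⟩ := exists_between (show max (1 / 2) (-β) < min (1 - c / 2) (1 - β) by
    rw [max_lt_iff, lt_min_iff, lt_min_iff]
    refine ⟨⟨by linarith, by linarith⟩, by linarith, by linarith⟩)
  rw [max_lt_iff] at ha1
  rw [lt_min_iff] at ha2
  refine ⟨c / k, a, div_pos hc1.1 hk0, ?_, ha1.1.le, by linarith, ha1.2, ha2.2, ?_⟩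
  · rw [lt_div_iff₀ hk0]
    linarith
  · rw [mul_div_cancel₀ c hk0.ne']
    linarith

theorem integrable_autocovariance_rpow {d lam b : ℝ} (hd : 0 < d) (hlam : 0 < lam) (hb : 0 < b)
    (hbd : 1 - 2 * d < b) {q : ℝ} (hq : 0 < q) (hbq : b * q < 1) :
    Integrable fun r => autocovariance d lam r ^ q := by
  obtain ⟨C, hC, hle⟩ := exists_autocovariance_le hd hlam hb hbd
  refine ((integrable_abs_rpow_mul_exp (s := b * q) (c := lam / 2 * q) hbq
    (by positivity)).const_mul (C ^ q)).mono'
    ((measurable_autocovariance d lam).pow_const q).aestronglyMeasurable ?_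
  filter_upwards [compl_mem_ae_iff.2 (measure_singleton (0 : ℝ))] with r hr
  have h0 := autocovariance_nonneg hd hlam r
  have hr0 : r ≠ 0 := hr
  rw [Real.norm_eq_abs, abs_of_nonneg (Real.rpow_nonneg h0 _)]
  refine (Real.rpow_le_rpow h0 (hle r hr) hq.le).trans (le_of_eq ?_)
  rw [Real.mul_rpow hC.le (by positivity), Real.mul_rpow (by positivity) (by positivity),
    ← Real.rpow_mul (abs_nonneg r), ← Real.exp_mul]
  ring_nf

/-- The integrand of the variance of the process at time `t`, up to the factor `k!`. -/
def varianceIntegrand (k : ℕ) (d lam β t : ℝ) (q : ℝ × ℝ) : ℝ :=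
  fracFilter β t q.1 * fracFilter β t q.2 * autocovariance d lam (q.1 - q.2) ^ k

theorem integrable_varianceIntegrand {k : ℕ} (hk : 1 ≤ k) {d lam β : ℝ} (hlam : 0 < lam)
    (hd : 1 / 2 - 1 / (2 * (k : ℝ)) < d) (hβ₁ : -1 < β)
    (hβ₂ : -(1 + (k : ℝ) * (d - 1 / 2)) < β) (hβ₃ : β < 1 / 2) (t : ℝ) :
    Integrable (varianceIntegrand k d lam β t) := by
  obtain ⟨hd0, b, a, hb, hbd, ha, ha1, haβ, haβ', hkb⟩ := exists_exponents hk hd hβ₁ hβ₂ hβ₃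
  have ha0 : 0 < a := by linarith
  have hk0 : (0 : ℝ) < k := by exact_mod_cast hk
  refine integrable_mul_mul_comp_sub (φ := fun r => autocovariance d lam r ^ k) ha ha1
    (measurable_fracFilter β t) ((measurable_autocovariance d lam).pow_const k)
    (integrable_abs_fracFilter_rpow (by positivity) (by linarith) ?_ ?_ t) ?_
  · rw [mul_one_div, lt_div_iff₀ ha0]
    linarith
  · rw [mul_one_div, div_lt_iff₀ ha0]
    linarith
  · have h1 : 0 < 2 - 2 * a := by linarith
    have h2 : ∀ r, |autocovariance d lam r ^ k| ^ (1 / (2 - 2 * a)) =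
        autocovariance d lam r ^ ((k : ℝ) * (1 / (2 - 2 * a))) := fun r => by
      have h0 := autocovariance_nonneg hd0 hlam r
      rw [abs_of_nonneg (pow_nonneg h0 k), Real.rpow_mul h0, Real.rpow_natCast]
    simp_rw [h2]
    refine integrable_autocovariance_rpow hd0 hlam hb hbd (by positivity) ?_
    rw [← mul_assoc, mul_one_div, div_lt_one h1]
    linarith

/-! ### The kernel -/

theorem kernelIntegrand_eq (k : ℕ) (d lam β t : ℝ) (x : Fin k → ℝ) (u : ℝ) :
    kernelIntegrand k d lam β t x u = fracFilter β t u * ∏ i, temperedKernel d lam (u - x i) :=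
  rfl

theorem measurable_kernelIntegrand (k : ℕ) (d lam β t : ℝ) :
    Measurable fun p : (Fin k → ℝ) × ℝ => kernelIntegrand k d lam β t p.1 p.2 := by
  have h1 := measurable_fracFilter β t
  have h2 := measurable_temperedKernel d lam
  simp_rw [kernelIntegrand_eq]
  refine (h1.comp measurable_snd).mul (Finset.measurable_fun_prod _ fun i _ => ?_)
  exact h2.comp (measurable_snd.sub ((measurable_pi_apply i).comp measurable_fst))

theorem stronglyMeasurable_kernel (k : ℕ) (d lam β t : ℝ) :
    StronglyMeasurable (kernel k d lam β t) :=
  StronglyMeasurable.integral_prod_right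
    (measurable_kernelIntegrand k d lam β t).stronglyMeasurable

theorem ae_fst_ne_snd : ∀ᵐ q : ℝ × ℝ, q.1 ≠ q.2 := by
  have h : MeasurableSet {q : ℝ × ℝ | q.1 = q.2} :=
    measurableSet_eq_fun measurable_fst measurable_snd
  have h0 : (volume : Measure (ℝ × ℝ)) {q : ℝ × ℝ | q.1 = q.2} = 0 := by
    refine (Measure.measure_prod_null h).2 (Filter.Eventually.of_forall fun x => ?_)
    have : Prod.mk x ⁻¹' {q : ℝ × ℝ | q.1 = q.2} = {x} := by
      ext y
      simp [eq_comm]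
    simp [this]
  exact measure_eq_zero_iff_ae_notMem.1 h0

theorem integrable_of_integrable_tensor_self {f : ℝ → ℝ} (hf : AEStronglyMeasurable f)
    (h : Integrable fun q : ℝ × ℝ => f q.1 * f q.2) : Integrable f := by
  refine ⟨hf, ?_⟩
  have h1 := h.2
  rw [hasFiniteIntegral_iff_enorm] at h1 ⊢
  simp_rw [enorm_mul] at h1
  rw [Measure.volume_eq_prod, lintegral_prod_mul hf.enorm hf.enorm] at h1
  by_contra h2
  rw [not_lt, top_le_iff] at h2
  rw [h2] at h1
  simp at h1

theorem kernelIntegrand_mul (k : ℕ) (d lam β t : ℝ) (x : Fin k → ℝ) (u v : ℝ) :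
    kernelIntegrand k d lam β t x u * kernelIntegrand k d lam β t x v =
      fracFilter β t u * fracFilter β t v *
        ∏ i, (temperedKernel d lam (u - x i) * temperedKernel d lam (v - x i)) := by
  rw [kernelIntegrand_eq, kernelIntegrand_eq, Finset.prod_mul_distrib]
  ring

section Variance

variable {k : ℕ} {d lam β : ℝ}

/-- For fixed `u ≠ v` the integral over `x` factorizes into `k` copies of the autocovariance. -/
theorem integral_kernelIntegrand_mul (hd : 0 < d) (hlam : 0 < lam) (t : ℝ) {u v : ℝ}
    (huv : u ≠ v) :
    Integrable (fun x => kernelIntegrand k d lam β t x u * kernelIntegrand k d lam β t x v) ∧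
      ∫ x, kernelIntegrand k d lam β t x u * kernelIntegrand k d lam β t x v =
        varianceIntegrand k d lam β t (u, v) ∧
      ∫ x, ‖kernelIntegrand k d lam β t x u * kernelIntegrand k d lam β t x v‖ =
        ‖varianceIntegrand k d lam β t (u, v)‖ := by
  obtain ⟨h1, h2⟩ := integrable_temperedKernel_sub hd hlam huv
  have h3 : ∫ x : Fin k → ℝ, ∏ i, (temperedKernel d lam (u - x i) * temperedKernel d lam (v - x i))
      = autocovariance d lam (u - v) ^ k := by
    rw [integral_fintype_prod_volume_eq_pow
      fun y => temperedKernel d lam (u - y) * temperedKernel d lam (v - y), h2, Fintype.card_fin]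
  have h4 : ∀ x : Fin k → ℝ,
      0 ≤ ∏ i, (temperedKernel d lam (u - x i) * temperedKernel d lam (v - x i)) := fun x =>
    Finset.prod_nonneg fun i _ => mul_nonneg (temperedKernel_nonneg _ _ _)
      (temperedKernel_nonneg _ _ _)
  simp_rw [kernelIntegrand_mul]
  refine ⟨(Integrable.fintype_prod fun _ => h1).const_mul _, ?_, ?_⟩
  · rw [integral_const_mul, h3, varianceIntegrand]
  · simp_rw [norm_mul _ (∏ i, _), Real.norm_of_nonneg (h4 _)]
    rw [integral_const_mul, h3, varianceIntegrand, norm_mul _ (_ ^ k),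
      Real.norm_of_nonneg (pow_nonneg (autocovariance_nonneg hd hlam _) k)]

theorem integrable_kernelIntegrand_mul (hd : 0 < d) (hlam : 0 < lam) (t : ℝ)
    (hV : Integrable (varianceIntegrand k d lam β t)) :
    Integrable fun p : (ℝ × ℝ) × (Fin k → ℝ) =>
      kernelIntegrand k d lam β t p.2 p.1.1 * kernelIntegrand k d lam β t p.2 p.1.2 := by
  have hm := measurable_kernelIntegrand k d lam β t
  have hm2 : Measurable fun p : (ℝ × ℝ) × (Fin k → ℝ) =>
      kernelIntegrand k d lam β t p.2 p.1.1 * kernelIntegrand k d lam β t p.2 p.1.2 :=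
    (hm.comp (measurable_snd.prodMk (measurable_fst.comp measurable_fst))).mul
      (hm.comp (measurable_snd.prodMk (measurable_snd.comp measurable_fst)))
  rw [Measure.volume_eq_prod, integrable_prod_iff hm2.aestronglyMeasurable]
  constructor
  · filter_upwards [ae_fst_ne_snd] with q hq
    exact (integral_kernelIntegrand_mul hd hlam t hq).1
  · refine hV.norm.congr ?_
    filter_upwards [ae_fst_ne_snd] with q hq
    exact (integral_kernelIntegrand_mul hd hlam t hq).2.2.symm

theorem ae_integrable_kernelIntegrand (hd : 0 < d) (hlam : 0 < lam) (t : ℝ)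
    (hV : Integrable (varianceIntegrand k d lam β t)) :
    ∀ᵐ x : Fin k → ℝ, Integrable (kernelIntegrand k d lam β t x) := by
  have h := integrable_kernelIntegrand_mul hd hlam t hV
  rw [Measure.volume_eq_prod] at h
  filter_upwards [h.prod_left_ae] with x hx
  exact integrable_of_integrable_tensor_self ((measurable_kernelIntegrand k d lam β t).comp
    measurable_prodMk_left).aestronglyMeasurable hx

theorem kernel_sq (t : ℝ) (x : Fin k → ℝ) :
    kernel k d lam β t x ^ 2 = ∫ q : ℝ × ℝ,
      kernelIntegrand k d lam β t x q.1 * kernelIntegrand k d lam β t x q.2 := by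
  rw [Measure.volume_eq_prod, integral_prod_mul, sq, kernel]

theorem memLp_kernel (hd : 0 < d) (hlam : 0 < lam) (t : ℝ)
    (hV : Integrable (varianceIntegrand k d lam β t)) :
    MemLp (kernel k d lam β t) 2 := by
  rw [memLp_two_iff_integrable_sq (stronglyMeasurable_kernel k d lam β t).aestronglyMeasurable]
  have h := integrable_kernelIntegrand_mul hd hlam t hV
  rw [Measure.volume_eq_prod] at h
  simp_rw [kernel_sq]
  exact h.integral_prod_right

theorem integral_kernel_sq (hd : 0 < d) (hlam : 0 < lam) (t : ℝ)
    (hV : Integrable (varianceIntegrand k d lam β t)) :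
    ∫ x, kernel k d lam β t x ^ 2 = ∫ q, varianceIntegrand k d lam β t q := by
  have h := integrable_kernelIntegrand_mul hd hlam t hV
  rw [Measure.volume_eq_prod] at h
  simp_rw [kernel_sq]
  rw [integral_integral_swap (f := fun (x : Fin k → ℝ) (q : ℝ × ℝ) =>
    kernelIntegrand k d lam β t x q.1 * kernelIntegrand k d lam β t x q.2) h.swap]
  refine integral_congr_ae ?_
  filter_upwards [ae_fst_ne_snd] with q hq
  exact (integral_kernelIntegrand_mul hd hlam t hq).2.1

/-! ### Stationarity of the increments and scaling -/

theorem kernel_perm (t : ℝ) (σ : Equiv.Perm (Fin k)) (x : Fin k → ℝ) :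
    kernel k d lam β t (fun i => x (σ i)) = kernel k d lam β t x := by
  unfold kernel
  congr 1
  ext u
  rw [kernelIntegrand_eq, kernelIntegrand_eq,
    Equiv.prod_comp σ fun i => temperedKernel d lam (u - x i)]

/-- Stationarity of the increments, at the level of the kernel. -/
theorem kernel_sub_kernel (t s : ℝ) {x : Fin k → ℝ}
    (ht : Integrable (kernelIntegrand k d lam β t x))
    (hs : Integrable (kernelIntegrand k d lam β s x)) :
    kernel k d lam β t x - kernel k d lam β s x = kernel k d lam β (t - s) (x - fun _ => s) := by
  rw [kernel, kernel, kernel, ← integral_sub ht hs,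
    ← integral_sub_right_eq_self (kernelIntegrand k d lam β (t - s) (x - fun _ => s)) s]
  congr 1
  ext u
  simp only [kernelIntegrand_eq, ← fracFilter_sub, Pi.sub_apply, sub_sub_sub_cancel_right]
  ring

theorem integral_kernel_sub_sq (hd : 0 < d) (hlam : 0 < lam)
    (hV : ∀ t, Integrable (varianceIntegrand k d lam β t)) (t s : ℝ) :
    ∫ x, (kernel k d lam β t x - kernel k d lam β s x) ^ 2 =
      ∫ x, kernel k d lam β (t - s) x ^ 2 := by
  rw [← integral_sub_right_eq_self (fun x => kernel k d lam β (t - s) x ^ 2)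
    (fun _ : Fin k => s)]
  refine integral_congr_ae ?_
  filter_upwards [ae_integrable_kernelIntegrand hd hlam t (hV t),
    ae_integrable_kernelIntegrand hd hlam s (hV s)] with x hx hx'
  rw [kernel_sub_kernel t s hx hx']

theorem kernel_zero (x : Fin k → ℝ) : kernel k d lam β 0 x = 0 := by
  simp [kernel, kernelIntegrand_eq, fracFilter_zero]

theorem posPow_mul {τ : ℝ} (hτ : 0 < τ) (x a : ℝ) : posPow (τ * x) a = τ ^ a * posPow x a := by
  by_cases hx : 0 < x
  · rw [posPow_of_pos hx, posPow_of_pos (by positivity), Real.mul_rpow hτ.le hx.le]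
  · rw [posPow_of_nonpos (not_lt.1 hx), posPow_of_nonpos, mul_zero]
    exact mul_nonpos_of_nonneg_of_nonpos hτ.le (not_lt.1 hx)

theorem varianceIntegrand_smul {τ : ℝ} (hτ : 0 < τ) (q : ℝ × ℝ) :
    varianceIntegrand k d lam β τ (τ • q) =
      τ ^ (2 * β + (k : ℝ) * (d - 1 / 2)) *
        (Real.Gamma d / (Real.sqrt Real.pi * (2 * lam) ^ (d - 1 / 2))) ^ k *
        constIntegrand k d lam β τ q.1 q.2 := by
  obtain ⟨u, v⟩ := q
  have h1 : ∀ w, fracFilter β τ (τ * w) = τ ^ β * (posPow (1 - w) β - posPow (-w) β) := fun w => by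
    rw [fracFilter, ← mul_neg, posPow_mul hτ, show τ - τ * w = τ * (1 - w) by ring,
      posPow_mul hτ]
    ring
  have h2 : ∀ y : ℝ, 0 ≤ y → (y ^ (d - 1 / 2)) ^ k = y ^ ((k : ℝ) * (d - 1 / 2)) := fun y hy => by
    rw [mul_comm, Real.rpow_mul_natCast hy]
  have h3 : |τ * u - τ * v| = τ * |u - v| := by
    rw [← mul_sub, abs_mul, abs_of_pos hτ]
  simp only [varianceIntegrand, constIntegrand, Prod.smul_mk, smul_eq_mul, h1, autocovariance, h3]
  rw [mul_pow, mul_pow, h2 _ (by positivity), Real.mul_rpow hτ.le (abs_nonneg _),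
    ← mul_assoc lam, Real.rpow_add hτ, show 2 * β = β + β by ring, Real.rpow_add hτ]
  ring

theorem integrable_constIntegrand (hd : 0 < d) (hlam : 0 < lam) {τ : ℝ} (hτ : 0 < τ)
    (hV : Integrable (varianceIntegrand k d lam β τ)) :
    Integrable fun q : ℝ × ℝ => constIntegrand k d lam β τ q.1 q.2 := by
  have h := (integrable_comp_smul_iff volume (varianceIntegrand k d lam β τ) hτ.ne').2 hV
  simp_rw [varianceIntegrand_smul hτ] at h
  have := Real.Gamma_pos_of_pos hd
  exact (integrable_const_mul_iff (isUnit_iff_ne_zero.2 (by positivity)) _).1 h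

theorem covConst_mul_rpow (hd : 0 < d) (hlam : 0 < lam) {τ : ℝ} (hτ : 0 < τ)
    (hV : Integrable (varianceIntegrand k d lam β τ)) :
    covConst k d lam β τ * τ ^ (2 * β + 2 + (k : ℝ) * (d - 1 / 2)) =
      k.factorial * ∫ q, varianceIntegrand k d lam β τ q := by
  have h := Measure.integral_comp_smul (volume : Measure (ℝ × ℝ))
    (varianceIntegrand k d lam β τ) τ
  simp_rw [varianceIntegrand_smul hτ] at h
  rw [integral_const_mul, abs_of_pos (by positivity), Module.finrank_prod, Module.finrank_self,
    smul_eq_mul] at h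
  have hi := integrable_constIntegrand hd hlam hτ hV
  rw [Measure.volume_eq_prod] at hi
  have hI : ∫ q : ℝ × ℝ, constIntegrand k d lam β τ q.1 q.2 =
      ∫ u, ∫ v, constIntegrand k d lam β τ u v := integral_prod _ hi
  rw [covConst, ← hI]
  have h2 : ∫ q, varianceIntegrand k d lam β τ q = τ ^ 2 *
      (τ ^ (2 * β + (k : ℝ) * (d - 1 / 2)) *
        (Real.Gamma d / (Real.sqrt Real.pi * (2 * lam) ^ (d - 1 / 2))) ^ k *
        ∫ q : ℝ × ℝ, constIntegrand k d lam β τ q.1 q.2) := by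
    rw [h]
    field_simp
  rw [h2, show 2 * β + 2 + (k : ℝ) * (d - 1 / 2) = 2 + (2 * β + (k : ℝ) * (d - 1 / 2)) by ring,
    Real.rpow_add hτ, Real.rpow_two]
  ring

/-- For negative `t` this follows from stationarity of the increments between `0` and `t`. -/
theorem covConst_abs_mul_rpow (hd : 0 < d) (hlam : 0 < lam)
    (he : 0 < 2 * β + 2 + (k : ℝ) * (d - 1 / 2))
    (hV : ∀ t, Integrable (varianceIntegrand k d lam β t)) (t : ℝ) :
    covConst k d lam β |t| * |t| ^ (2 * β + 2 + (k : ℝ) * (d - 1 / 2)) =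
      k.factorial * ∫ x, kernel k d lam β t x ^ 2 := by
  have hpos : ∀ τ : ℝ, 0 < τ → covConst k d lam β τ * τ ^ (2 * β + 2 + (k : ℝ) * (d - 1 / 2)) =
      k.factorial * ∫ x, kernel k d lam β τ x ^ 2 := fun τ hτ => by
    rw [integral_kernel_sq hd hlam τ (hV τ), covConst_mul_rpow hd hlam hτ (hV τ)]
  rcases lt_trichotomy t 0 with ht | rfl | ht
  · have h := integral_kernel_sub_sq hd hlam hV 0 t
    simp only [kernel_zero, zero_sub, neg_sq] at h
    rw [abs_of_neg ht, hpos (-t) (neg_pos.2 ht), h]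
  · rw [abs_zero, Real.zero_rpow he.ne']
    simp [kernel_zero]
  · rw [abs_of_pos ht, hpos t ht]

theorem integral_kernel_mul (hd : 0 < d) (hlam : 0 < lam)
    (hV : ∀ t, Integrable (varianceIntegrand k d lam β t)) (t s : ℝ) :
    ∫ x, kernel k d lam β t x * kernel k d lam β s x =
      1 / 2 * ((∫ x, kernel k d lam β t x ^ 2) + (∫ x, kernel k d lam β s x ^ 2) -
        ∫ x, kernel k d lam β (t - s) x ^ 2) := by
  have h1 := memLp_kernel hd hlam t (hV t)
  have h2 := memLp_kernel hd hlam s (hV s)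
  have hts : Integrable fun x => 2 * (kernel k d lam β t x * kernel k d lam β s x) :=
    (h1.integrable_mul h2).const_mul 2
  have htt : Integrable fun x => kernel k d lam β t x ^ 2 := h1.integrable_sq
  have hss : Integrable fun x => kernel k d lam β s x ^ 2 := h2.integrable_sq
  have hsub : Integrable fun x =>
      kernel k d lam β t x ^ 2 - 2 * (kernel k d lam β t x * kernel k d lam β s x) := htt.sub hts
  rw [← integral_kernel_sub_sq hd hlam hV t s]
  have h3 : ∀ x, (kernel k d lam β t x - kernel k d lam β s x) ^ 2 =
      kernel k d lam β t x ^ 2 - 2 * (kernel k d lam β t x * kernel k d lam β s x) +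
        kernel k d lam β s x ^ 2 := fun x => by ring
  simp_rw [h3]
  rw [integral_add hsub hss, integral_sub htt hts, integral_const_mul]
  ring

end Variance

end TemperedHermite

end

theorem proposition5p6 {Ω : Type*} [MeasurableSpace Ω] (P : Measure Ω) [IsProbabilityMeasure P]
    (W : TemperedHermite.FinMeasSet → Ω → ℝ) (hW : TemperedHermite.IsWhiteNoise W P)
    (k : ℕ) (hk : 1 ≤ k) (d lam β : ℝ) (hlam : 0 < lam)
    (hd : 1 / 2 - 1 / (2 * (k : ℝ)) < d)
    (hβ₁ : -1 < β) (hβ₂ : -(1 + (k : ℝ) * (d - 1 / 2)) < β) (hβ₃ : β < 1 / 2) (hβ₀ : β ≠ 0) :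
    -- the process is well defined
    (∀ t : ℝ,
      (∀ᵐ x : Fin k → ℝ, Integrable (TemperedHermite.kernelIntegrand k d lam β t x)) ∧
      MemLp (TemperedHermite.kernel k d lam β t) 2 volume) ∧
    -- the double integral in `C_τ` converges absolutely
    (∀ τ : ℝ, 0 < τ →
      Integrable fun p : ℝ × ℝ => TemperedHermite.constIntegrand k d lam β τ p.1 p.2) ∧
    -- the covariance function
    ∀ t s : ℝ,
      ∫ ω, TemperedHermite.process W P k d lam β t ω *
          TemperedHermite.process W P k d lam β s ω ∂P =
        1 / 2 *
          (TemperedHermite.covConst k d lam β |t| *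
              |t| ^ (2 * β + 2 + (k : ℝ) * (d - 1 / 2)) +
            TemperedHermite.covConst k d lam β |s| *
              |s| ^ (2 * β + 2 + (k : ℝ) * (d - 1 / 2)) -
            TemperedHermite.covConst k d lam β |t - s| *
              |t - s| ^ (2 * β + 2 + (k : ℝ) * (d - 1 / 2))) := by
  have hV := TemperedHermite.integrable_varianceIntegrand hk hlam hd hβ₁ hβ₂ hβ₃
  have hd0 := (TemperedHermite.exists_exponents hk hd hβ₁ hβ₂ hβ₃).1
  -- the exponent is the sum of the positive numbers `1 + β` and `H + β`
  have he : 0 < 2 * β + 2 + (k : ℝ) * (d - 1 / 2) := by linarith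
  refine ⟨fun t => ⟨TemperedHermite.ae_integrable_kernelIntegrand hd0 hlam t (hV t),
    TemperedHermite.memLp_kernel hd0 hlam t (hV t)⟩,
    fun τ hτ => TemperedHermite.integrable_constIntegrand hd0 hlam hτ (hV τ), fun t s => ?_⟩
  rw [TemperedHermite.covConst_abs_mul_rpow hd0 hlam he hV,
    TemperedHermite.covConst_abs_mul_rpow hd0 hlam he hV,
    TemperedHermite.covConst_abs_mul_rpow hd0 hlam he hV]
  simp only [TemperedHermite.process]
  rw [TemperedHermite.integral_wienerItoIntegral_mul hW
    (TemperedHermite.memLp_kernel hd0 hlam t (hV t))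
    (TemperedHermite.memLp_kernel hd0 hlam s (hV s))
    (TemperedHermite.kernel_perm s), TemperedHermite.integral_kernel_mul hd0 hlam hV]
  ring
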